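/- Let $\mathbb T=\mathbb R/2\pi\mathbb Z$ with Lebesgue measure, let all function spaces be complex valued, and let $\langle f,g\rangle=\int_{\mathbb T} f\bar g\,dy$. For $\nu>0$ and $\beta\in\mathbb R$ let $$L_1u=\nu u''-\nu u-\frac{i\beta}{\nu}\sin y\,u,\qquad D(L_1)=H^2(\mathbb T)\subset L^2(\mathbb T).$$ For $\nu>0$, $\gamma\in\mathbb R$, $k_f>0$ and $k_1,k_3\in\mathbb Z$, $(k_1,k_3)\neq(0,0)$, let $$\mathcal L'_{k_1,k_3}f=-\nu k_f^2f''+\frac{ik_1}{k_f^2}\frac{\gamma}{\nu}\sin y\,\Big(1-\Big(\tfrac{k_1^2+k_3^2}{k_f^2}-\partial_y^2\Big)^{-1}\Big)f,\qquad D(\mathcal L'_{k_1,k_3})=H^2(\mathbb T).$$ Let $X=\{f\in L^2(\mathbb T):\int_{\mathbb T}f\,dy=0\}$ with the norm $\|f\|_*=\langle f,f-(1-\partial_y^2)^{-1}f\rangle^{1/2}$, let $\mathbb Q_1$ be the orthogonal projection of $L^2(\mathbb T)$ onto $X$, regard $\mathbb Q_1\mathcal L'_{k_1,k_3}$ as an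 operator in $X$ with domain $H^2(\mathbb T)\cap X$, and let $$\Psi(\mathbb Q_1\mathcal L'_{k_1,k_3})=\inf\big\{\|(\mathbb Q_1\mathcal L'_{k_1,k_3}-i\lambda)f\|_*:\ f\in H^2(\mathbb T)\cap X,\ \lambda\in\mathbb R,\ \|f\|_*=1\big\}.$$ There are absolute constants $C,c>0$ such that the following holds. 1. For all $\nu>0$ and $\beta\in\mathbb R\setminus\{0\}$ the operator $L_1:H^2(\mathbb T)\to L^2(\mathbb T)$ is invertible, with an inverse that is bounded on $L^2(\mathbb T)$, and for all $f\in L^2(\mathbb T)$ $$\|L_1^{-1}f\|_{L^2}\le C|\beta|^{-2/3}\nu^{1/3}\|f\|_{L^2},\qquad \|L_1^{-1}f\|_{L^1}\le C|\beta|^{-5/6}\nu^{2/3}\|f\|_{L^2}.$$ 2. If moreover $\nu^2\le|\beta|$, then $|\langle L_1^{-1}1,1\rangle|\ge c\,\nu/|\beta|$. 3. For all $\nu>0$, $\gamma\in\mathbb R$, $k_f>0$ and $k_1,k_3\in\mathbb Z$ with $k_1^2+k_3^2=k_f^2=1$, $$\Psi(\mathbb Q_1\mathcal L'_{k_1,k_3})\ge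 c\,|k_1\gamma|^{1/2}.$$ -/

import Mathlib

open MeasureTheory
open scoped ContDiff

noncomputable section

namespace KolmogorovFlow

instance factTwoPiPos : Fact (0 < 2 * Real.pi) := ⟨Real.two_pi_pos⟩

/-- The torus of length `2π`, with Lebesgue measure of total mass `2π`. -/
abbrev Torus : Type := AddCircle (2 * Real.pi)

/-- Complex valued square integrable functions on the torus. -/
abbrev L2T : Type := Lp ℂ 2 (volume : Measure Torus)

/-- Smooth `2π`-periodic test functions. -/
def IsTestFunction (φ : ℝ → ℂ) : Prop :=
  ContDiff ℝ ∞ φ ∧ Function.Periodic φ (2 * Real.pi)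

/-- `g` is the weak derivative of `f` on the torus. -/
def IsWeakDeriv (f g : L2T) : Prop :=
  ∀ φ : ℝ → ℂ, IsTestFunction φ →
    ∫ y in (0 : ℝ)..(2 * Real.pi), f (y : Torus) * deriv φ y =
      -∫ y in (0 : ℝ)..(2 * Real.pi), g (y : Torus) * φ y

/-! ### Helper facts: weak derivatives in terms of Fourier coefficients -/

/-- Pairing with a continuous periodic function is a continuous linear functional. -/
theorem exists_pairing (φ : ℝ → ℂ) (hc : Continuous φ) (hp : Function.Periodic φ (2 * Real.pi)) :
    ∃ Φ : L2T, ∀ f : L2T,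
      ∫ y in (0 : ℝ)..(2 * Real.pi), f (y : Torus) * φ y = inner ℂ Φ f := by
  have hcl : Continuous (hp.lift : Torus → ℂ) := continuous_coinduced_dom.mpr hc
  let ψ : C(Torus, ℂ) := ⟨fun x => star (hp.lift x), hcl.star⟩
  refine ⟨ContinuousMap.toLp 2 volume ℂ ψ, fun f => ?_⟩
  rw [L2.inner_def]
  have h1 : ∫ a : Torus, inner ℂ ((ContinuousMap.toLp 2 volume ℂ ψ : L2T) a) (f a) =
      ∫ a : Torus, f a * hp.lift a := by
    refine integral_congr_ae ?_
    filter_upwards [ContinuousMap.coeFn_toLp (p := 2) (𝕜 := ℂ) volume ψ] with a ha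
    rw [ha]
    simp [ψ]
  rw [h1, ← AddCircle.intervalIntegral_preimage (2 * Real.pi) 0]
  simp

/-- The exponential `e^{iny}` as an element of `L²`. -/
def expL2 (n : ℤ) : L2T := ContinuousMap.toLp 2 volume ℂ (fourier n)

theorem inner_expL2 (n : ℤ) (f : L2T) :
    inner ℂ (expL2 n) f = ((2 * Real.pi : ℝ) : ℂ) * fourierCoeff (f : Torus → ℂ) n := by
  rw [L2.inner_def]
  have h1 : ∫ a : Torus, inner ℂ (expL2 n a) (f a) = ∫ a : Torus, fourier (-n) a • f a := by
    refine integral_congr_ae ?_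
    filter_upwards [ContinuousMap.coeFn_toLp (p := 2) (𝕜 := ℂ) volume (fourier n)] with a ha
    rw [expL2, ha]
    simp [mul_comm]
  rw [h1, fourierCoeff, AddCircle.integral_haarAddCircle, Complex.real_smul, ← mul_assoc,
    ← Complex.ofReal_mul, mul_inv_cancel₀ Real.two_pi_pos.ne']
  simp

theorem eq_zero_of_inner_expL2 (f : L2T) (h : ∀ n, inner ℂ (expL2 n) f = 0) : f = 0 := by
  have hm : MemLp (f : Torus → ℂ) 2 AddCircle.haarAddCircle := (Lp.memLp f).haarAddCircle
  have h0 : hm.toLp f = 0 := by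
    apply fourierBasis.repr.injective
    ext n
    rw [fourierBasis_repr, fourierCoeff_congr_ae hm.coeFn_toLp]
    have := h n
    rw [inner_expL2] at this
    have h2 : ((2 * Real.pi : ℝ) : ℂ) ≠ 0 := Complex.ofReal_ne_zero.mpr Real.two_pi_pos.ne'
    simpa [h2] using this
  have h1 : (f : Torus → ℂ) =ᵐ[AddCircle.haarAddCircle] 0 :=
    hm.coeFn_toLp.symm.trans (by rw [h0]; exact Lp.coeFn_zero _ _ _)
  apply Lp.ext
  refine Filter.EventuallyEq.trans ?_ (Lp.coeFn_zero _ _ _).symm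
  have h2 : ∀ᵐ x ∂(ENNReal.ofReal (2 * Real.pi) • (AddCircle.haarAddCircle : Measure Torus)),
      (f : Torus → ℂ) x = 0 := Measure.ae_smul_measure h1 _
  exact h2

theorem inner_expL2_expL2 (m n : ℤ) :
    inner ℂ (expL2 m) (expL2 n) = if m = n then ((2 * Real.pi : ℝ) : ℂ) else 0 := by
  rw [inner_expL2]
  have h1 : (expL2 n : Torus → ℂ) =ᵐ[AddCircle.haarAddCircle] (fourier n : C(Torus, ℂ)) := by
    have h := ContinuousMap.coeFn_toLp (p := 2) (𝕜 := ℂ) (volume : Measure Torus) (fourier n)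
    have h2 : ∀ᵐ x ∂(ENNReal.ofReal (2 * Real.pi) • (AddCircle.haarAddCircle : Measure Torus)),
        expL2 n x = (fourier n : C(Torus, ℂ)) x := h
    exact (Measure.ae_ennreal_smul_measure_iff (by simp [Real.pi_pos])).mp h2
  rw [fourierCoeff_congr_ae h1, fourierCoeff_fourier]
  by_cases hmn : m = n <;> simp [hmn]

/-- The normalised exponentials form a Hilbert basis of `L²`. -/
def expBasis : HilbertBasis ℤ ℂ L2T :=
  HilbertBasis.mkOfOrthogonalEqBot
    (v := fun n => (((Real.sqrt (2 * Real.pi))⁻¹ : ℝ) : ℂ) • expL2 n)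
    (by
      rw [orthonormal_iff_ite]
      intro m n
      have h : (Real.sqrt (2 * Real.pi))⁻¹ * ((Real.sqrt (2 * Real.pi))⁻¹ * (2 * Real.pi)) = 1 := by
        have h2 := Real.mul_self_sqrt Real.two_pi_pos.le
        have h3 : Real.sqrt (2 * Real.pi) ≠ 0 := (Real.sqrt_pos.mpr Real.two_pi_pos).ne'
        field_simp
        nlinarith
      rw [inner_smul_left, inner_smul_right, inner_expL2_expL2]
      split_ifs
      · rw [Complex.conj_ofReal]
        exact_mod_cast h
      · simp)
    (by
      rw [Submodule.eq_bot_iff]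
      intro f hf
      refine eq_zero_of_inner_expL2 f fun n => ?_
      have h := (Submodule.mem_orthogonal _ _).mp hf _ (Submodule.subset_span ⟨n, rfl⟩)
      simp only [inner_smul_left] at h
      refine (mul_eq_zero.mp h).resolve_left ?_
      simp [Real.sqrt_eq_zero', Real.pi_pos])

theorem expBasis_apply (n : ℤ) :
    expBasis n = (((Real.sqrt (2 * Real.pi))⁻¹ : ℝ) : ℂ) • expL2 n := by
  simp [expBasis]

theorem inner_expBasis (n : ℤ) (f : L2T) :
    inner ℂ (expBasis n) f = (((Real.sqrt (2 * Real.pi))⁻¹ : ℝ) : ℂ) * inner ℂ (expL2 n) f := by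
  rw [expBasis_apply, inner_smul_left, Complex.conj_ofReal]

theorem hasDerivAt_exp (n : ℤ) (x : ℝ) :
    HasDerivAt (fun y : ℝ => fourier n (y : Torus))
      (Complex.I * n * fourier n (x : Torus)) x := by
  have h := hasDerivAt_fourier (2 * Real.pi) n x
  convert h using 2
  have : (Real.pi : ℂ) ≠ 0 := Complex.ofReal_ne_zero.mpr Real.pi_pos.ne'
  push_cast
  field_simp

theorem isTestFunction_exp (n : ℤ) :
    IsTestFunction (fun y : ℝ => (fourier n (y : Torus) : ℂ)) := by
  refine ⟨?_, fun y => ?_⟩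
  · simp_rw [fourier_coe_apply]
    have h : ContDiff ℝ ∞ fun y : ℝ => (y : ℂ) := Complex.ofRealCLM.contDiff
    exact ((contDiff_const.mul h).div_const _).cexp
  · have : ((y + 2 * Real.pi : ℝ) : Torus) = (y : Torus) := by
      rw [AddCircle.coe_add, AddCircle.coe_period, add_zero]
    simp only [this]

theorem integral_expL2 (n : ℤ) (φ : ℝ → ℂ)
    (hp : Function.Periodic φ (2 * Real.pi)) :
    ∫ y in (0 : ℝ)..(2 * Real.pi), expL2 n (y : Torus) * φ y =
      ∫ y in (0 : ℝ)..(2 * Real.pi), fourier n (y : Torus) * φ y := by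
  have key : ∀ F : Torus → ℂ, ∫ y in (0 : ℝ)..(2 * Real.pi), F (y : Torus) * φ y =
      ∫ a : Torus, F a * hp.lift a := by
    intro F
    rw [← AddCircle.intervalIntegral_preimage (2 * Real.pi) 0]
    simp
  rw [key, key]
  refine integral_congr_ae ?_
  filter_upwards [ContinuousMap.coeFn_toLp (p := 2) (𝕜 := ℂ) volume (fourier n)] with a ha
  rw [expL2, ha]

theorem integral_exp_mul (n : ℤ) (f : L2T) :
    ∫ y in (0 : ℝ)..(2 * Real.pi), f (y : Torus) * fourier (-n) (y : Torus) =
      inner ℂ (expL2 n) f := by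
  rw [inner_expL2, fourierCoeff_eq_intervalIntegral _ _ 0]
  rw [Complex.real_smul, ← mul_assoc, ← Complex.ofReal_mul,
    mul_one_div_cancel Real.two_pi_pos.ne']
  simp [mul_comm]

/-- Weak differentiation multiplies the `n`-th Fourier coefficient by `in`. -/
theorem isWeakDeriv_iff (f g : L2T) :
    IsWeakDeriv f g ↔ ∀ n : ℤ, inner ℂ (expL2 n) g = Complex.I * n * inner ℂ (expL2 n) f := by
  constructor
  · intro h n
    have h1 := h _ (isTestFunction_exp (-n))
    have h2 : ∀ y : ℝ, deriv (fun y : ℝ => (fourier (-n) (y : Torus) : ℂ)) y =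
        (-(Complex.I * n)) * fourier (-n) (y : Torus) := fun y => by
      rw [(hasDerivAt_exp (-n) y).deriv]
      push_cast
      ring
    simp only [h2, mul_left_comm _ (-(Complex.I * (n : ℂ)))] at h1
    rw [intervalIntegral.integral_const_mul, integral_exp_mul, integral_exp_mul] at h1
    linear_combination h1
  · intro h φ hφ
    have hd : Continuous (deriv φ) := hφ.1.continuous_deriv (by simp)
    have hdp : Function.Periodic (deriv φ) (2 * Real.pi) := fun y => by
      have : (fun x => φ (x + 2 * Real.pi)) = φ := funext hφ.2
      rw [← deriv_comp_add_const, this]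
    obtain ⟨Φ, hΦ⟩ := exists_pairing φ hφ.1.continuous hφ.2
    obtain ⟨Ψ, hΨ⟩ := exists_pairing (deriv φ) hd hdp
    rw [hΦ, hΨ]
    have key : ∀ n : ℤ, inner ℂ Ψ (expL2 n) = -(Complex.I * n) * inner ℂ Φ (expL2 n) := by
      intro n
      rw [← hΦ, ← hΨ, integral_expL2 n _ hdp, integral_expL2 n _ hφ.2]
      rw [intervalIntegral.integral_mul_deriv_eq_deriv_mul
        (u' := fun x : ℝ => Complex.I * n * fourier n (x : Torus))
        (fun x _ => hasDerivAt_exp n x)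
        (fun x _ => ((hφ.1.differentiable (by simp)) x).hasDerivAt)
        (Continuous.intervalIntegrable (by
          have := (isTestFunction_exp n).1.continuous
          fun_prop) _ _)
        (hd.intervalIntegrable _ _)]
      have e1 : φ (2 * Real.pi) = φ 0 := by simpa using hφ.2 0
      simp only [mul_assoc, intervalIntegral.integral_const_mul]
      have e2 : ((2 * Real.pi : ℝ) : Torus) = ((0 : ℝ) : Torus) := by
        rw [AddCircle.coe_period, AddCircle.coe_zero]
      rw [e1, e2]
      ring
    rw [← (expBasis.hasSum_inner_mul_inner Ψ f).tsum_eq,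
      ← (expBasis.hasSum_inner_mul_inner Φ g).tsum_eq, ← tsum_neg]
    refine tsum_congr fun n => ?_
    rw [inner_expBasis, inner_expBasis, expBasis_apply, inner_smul_right, inner_smul_right,
      key, h]
    ring

/-- The pairs `(f, f'')` with `f` twice weakly differentiable in `L²`. -/
def secondDerivGraph : Submodule ℂ (L2T × L2T) where
  carrier := {p | ∃ g : L2T, IsWeakDeriv p.1 g ∧ IsWeakDeriv g p.2}
  add_mem' := by
    rintro p q ⟨g, h1, h2⟩ ⟨k, h3, h4⟩
    refine ⟨g + k, ?_, ?_⟩ <;> rw [isWeakDeriv_iff] at * <;> intro n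
    · rw [Prod.fst_add, inner_add_right, inner_add_right, h1, h3]; ring
    · rw [Prod.snd_add, inner_add_right, inner_add_right, h2, h4]; ring
  zero_mem' := by
    refine ⟨0, ?_, ?_⟩ <;> rw [isWeakDeriv_iff] <;> intro n <;> simp
  smul_mem' := by
    rintro c p ⟨g, h1, h2⟩
    refine ⟨c • g, ?_, ?_⟩ <;> rw [isWeakDeriv_iff] at * <;> intro n
    · rw [Prod.smul_fst, inner_smul_right, inner_smul_right, h1]; ring
    · rw [Prod.smul_snd, inner_smul_right, inner_smul_right, h2]; ring

theorem inner_of_mem_secondDerivGraph {p : L2T × L2T} (hp : p ∈ secondDerivGraph) (n : ℤ) :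
    inner ℂ (expL2 n) p.2 = -(n : ℂ) ^ 2 * inner ℂ (expL2 n) p.1 := by
  obtain ⟨g, h1, h2⟩ := hp
  rw [isWeakDeriv_iff] at h1 h2
  rw [h2, h1]
  linear_combination (n : ℂ) ^ 2 * inner ℂ (expL2 n) p.1 * Complex.I_sq

/-- The second weak derivative is unique. -/
theorem secondDerivGraph_single_valued (p : L2T × L2T) (hp : p ∈ secondDerivGraph)
    (h0 : p.1 = 0) : p.2 = 0 := by
  refine eq_zero_of_inner_expL2 _ fun n => ?_
  rw [inner_of_mem_secondDerivGraph hp, h0]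
  simp

/-- The operator `f ↦ f''` on `L²`, with domain the Sobolev space `H²`. -/
def D2 : L2T →ₗ.[ℂ] L2T := secondDerivGraph.toLinearPMap

/-- The Sobolev space `H²` of the torus. -/
def H2 : Submodule ℂ L2T := D2.domain

/-- The map `u ↦ u''` on `H²`. -/
def secondDeriv : H2 →ₗ[ℂ] L2T := D2.toFun

theorem D2_graph : D2.graph = secondDerivGraph :=
  Submodule.toLinearPMap_graph_eq _ secondDerivGraph_single_valued

theorem mem_H2_iff (f : L2T) :
    f ∈ H2 ↔ ∃ g h : L2T, IsWeakDeriv f g ∧ IsWeakDeriv g h := by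
  rw [H2, LinearPMap.mem_domain_iff, D2_graph]
  exact exists_comm

theorem inner_expL2_secondDeriv (u : H2) (n : ℤ) :
    inner ℂ (expL2 n) (secondDeriv u) = -(n : ℂ) ^ 2 * inner ℂ (expL2 n) (u : L2T) := by
  have h := LinearPMap.mem_graph D2 u
  rw [D2_graph] at h
  exact inner_of_mem_secondDerivGraph h n

theorem secondDeriv_eq_iff (u : H2) (h : L2T) :
    secondDeriv u = h ↔ ∃ g : L2T, IsWeakDeriv (u : L2T) g ∧ IsWeakDeriv g h := by
  have hu := LinearPMap.mem_graph D2 u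
  rw [D2_graph] at hu
  constructor
  · rintro rfl
    exact hu
  · intro hg
    rw [← sub_eq_zero]
    exact secondDerivGraph_single_valued _
      (secondDerivGraph.sub_mem hu (show ((u : L2T), h) ∈ secondDerivGraph from hg)) (sub_self _)

/-- The map `u ↦ s u - u''` from `H²` to `L²`. -/
def helmholtz (s : ℝ) : H2 →ₗ[ℂ] L2T := (s : ℂ) • H2.subtype - secondDeriv

theorem inner_expL2_helmholtz (s : ℝ) (u : H2) (n : ℤ) :
    inner ℂ (expL2 n) (helmholtz s u) =
      ((s + (n : ℝ) ^ 2 : ℝ) : ℂ) * inner ℂ (expL2 n) (u : L2T) := by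
  have h : helmholtz s u = (s : ℂ) • (u : L2T) - secondDeriv u := rfl
  rw [h, inner_sub_right, inner_smul_right, inner_expL2_secondDeriv]
  push_cast
  ring

theorem exists_multiplier (m : ℤ → ℂ) (C : ℝ) (hm : ∀ n, ‖m n‖ ≤ C) (f : L2T) :
    ∃ u : L2T, ∀ n, inner ℂ (expL2 n) u = m n * inner ℂ (expL2 n) f := by
  have hmem : Memℓp (fun n => m n * expBasis.repr f n) 2 := by
    rw [memℓp_gen_iff (by norm_num)]
    have h1 := (memℓp_gen_iff (by norm_num)).mp (lp.memℓp (expBasis.repr f))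
    refine Summable.of_nonneg_of_le (fun n => by positivity) (fun n => ?_) (h1.mul_left (C ^ 2))
    have h2 : (2 : ENNReal).toReal = ((2 : ℕ) : ℝ) := by norm_num
    rw [h2, Real.rpow_natCast, Real.rpow_natCast, norm_mul, mul_pow]
    have := hm n
    gcongr
  refine ⟨expBasis.repr.symm ⟨_, hmem⟩, fun n => ?_⟩
  have h1 := expBasis.repr_apply_apply (expBasis.repr.symm ⟨_, hmem⟩) n
  rw [LinearIsometryEquiv.apply_symm_apply] at h1
  change m n * expBasis.repr f n = _ at h1
  rw [expBasis.repr_apply_apply, inner_expBasis, inner_expBasis] at h1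
  have h3 : (((Real.sqrt (2 * Real.pi))⁻¹ : ℝ) : ℂ) ≠ 0 :=
    Complex.ofReal_ne_zero.mpr (inv_ne_zero (Real.sqrt_pos.mpr Real.two_pi_pos).ne')
  apply mul_left_cancel₀ h3
  rw [← h1]
  ring

theorem helmholtz_bijective {s : ℝ} (hs : 0 < s) : Function.Bijective (helmholtz s) := by
  have hpos : ∀ n : ℤ, 0 < s + (n : ℝ) ^ 2 := fun n => by positivity
  have hne : ∀ n : ℤ, ((s + (n : ℝ) ^ 2 : ℝ) : ℂ) ≠ 0 := fun n =>
    Complex.ofReal_ne_zero.mpr (hpos n).ne'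
  constructor
  · rw [injective_iff_map_eq_zero]
    intro u hu
    refine Subtype.ext (eq_zero_of_inner_expL2 _ fun n => ?_)
    have h := inner_expL2_helmholtz s u n
    rw [hu, inner_zero_right] at h
    exact (mul_eq_zero.mp h.symm).resolve_left (hne n)
  · intro f
    obtain ⟨u, hu⟩ := exists_multiplier (fun n => ((s + (n : ℝ) ^ 2 : ℝ) : ℂ)⁻¹) s⁻¹ (fun n => by
      rw [norm_inv, Complex.norm_real, Real.norm_of_nonneg (hpos n).le]
      gcongr
      nlinarith [sq_nonneg (n : ℝ)]) f
    obtain ⟨w, hw⟩ := exists_multiplier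
      (fun n => Complex.I * n * ((s + (n : ℝ) ^ 2 : ℝ) : ℂ)⁻¹) (1 + s⁻¹) (fun n => by
      rw [norm_mul, norm_mul, norm_inv, Complex.norm_real, Real.norm_of_nonneg (hpos n).le,
        Complex.norm_I, one_mul, Complex.norm_intCast, ← div_eq_mul_inv, div_le_iff₀ (hpos n)]
      have h1 : s⁻¹ * s = 1 := inv_mul_cancel₀ hs.ne'
      have h2 : (1 + s⁻¹) * (s + (n : ℝ) ^ 2) = s + |(n : ℝ)| ^ 2 + 1 + s⁻¹ * |(n : ℝ)| ^ 2 := by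
        rw [sq_abs]
        linear_combination h1
      have h3 : 0 ≤ s⁻¹ * |(n : ℝ)| ^ 2 := by positivity
      rw [h2]
      nlinarith [sq_nonneg (|(n : ℝ)| - 1)]) f
    obtain ⟨v, hv⟩ : ∃ v : L2T, v = (s : ℂ) • u - f := ⟨_, rfl⟩
    have huw : IsWeakDeriv u w := by
      rw [isWeakDeriv_iff]
      intro n
      rw [hw, hu]
      ring
    have hwv : IsWeakDeriv w v := by
      rw [isWeakDeriv_iff]
      intro n
      rw [hw, hv, inner_sub_right, inner_smul_right, hu]
      have h1 := mul_inv_cancel₀ (hne n)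
      have h2 : ((s + (n : ℝ) ^ 2 : ℝ) : ℂ) = (s : ℂ) + (n : ℂ) ^ 2 := by push_cast; ring
      linear_combination inner ℂ (expL2 n) f * h1 -
        inner ℂ (expL2 n) f * ((s + (n : ℝ) ^ 2 : ℝ) : ℂ)⁻¹ * h2 -
        inner ℂ (expL2 n) f * ((s + (n : ℝ) ^ 2 : ℝ) : ℂ)⁻¹ * (n : ℂ) ^ 2 * Complex.I_sq
    have hmem : u ∈ H2 := (mem_H2_iff u).mpr ⟨w, v, huw, hwv⟩
    refine ⟨⟨u, hmem⟩, ?_⟩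
    rw [← sub_eq_zero]
    refine eq_zero_of_inner_expL2 _ fun n => ?_
    rw [inner_sub_right, inner_expL2_helmholtz, hu, mul_inv_cancel_left₀ (hne n), sub_self]

/-! ### The operators -/

/-- The operator `(s - ∂²)⁻¹` on `L²`, for `s > 0` (it is only used there). -/
def helmholtzInv (s : ℝ) : L2T →ₗ[ℂ] L2T :=
  if hs : 0 < s then
    H2.subtype ∘ₗ
      ((LinearEquiv.ofBijective (helmholtz s) (helmholtz_bijective hs)).symm : L2T →ₗ[ℂ] H2)
  else 0

theorem helmholtzInv_eq_iff {s : ℝ} (hs : 0 < s) (f : L2T) (u : H2) :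
    helmholtzInv s f = u ↔ (s : ℂ) • (u : L2T) - secondDeriv u = f := by
  have h : helmholtzInv s f =
      (((LinearEquiv.ofBijective (helmholtz s) (helmholtz_bijective hs)).symm f : H2) : L2T) := by
    rw [helmholtzInv, dif_pos hs]
    rfl
  rw [h, Subtype.coe_inj, LinearEquiv.symm_apply_eq, eq_comm]
  rfl

/-- The sine function on the torus. -/
def sinT : Torus → ℝ := Real.sin_periodic.lift

theorem continuous_sinT : Continuous sinT := continuous_coinduced_dom.mpr Real.continuous_sin

theorem norm_sinT_le (x : Torus) : ‖(sinT x : ℂ)‖ ≤ 1 := by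
  induction x using QuotientAddGroup.induction_on with
  | H y =>
    rw [Complex.norm_real]
    exact Real.abs_sin_le_one y

theorem memLp_sin_mul (f : L2T) :
    MemLp (fun x : Torus => (sinT x : ℂ) * f x) 2 volume := by
  have h : Continuous fun x : Torus => (sinT x : ℂ) :=
    Complex.continuous_ofReal.comp continuous_sinT
  refine (Lp.memLp f).of_le (h.aestronglyMeasurable.mul (Lp.aestronglyMeasurable f)) ?_
  refine Filter.Eventually.of_forall fun x => ?_
  rw [norm_mul]
  exact mul_le_of_le_one_left (norm_nonneg _) (norm_sinT_le x)

/-- Multiplication by `sin y` on `L²`. -/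
def mulSin : L2T →ₗ[ℂ] L2T where
  toFun f := (memLp_sin_mul f).toLp _
  map_add' f g := by
    rw [← MemLp.toLp_add, MemLp.toLp_eq_toLp_iff]
    filter_upwards [Lp.coeFn_add f g] with x hx
    rw [hx]
    exact mul_add _ _ _
  map_smul' c f := by
    rw [RingHom.id_apply, ← MemLp.toLp_const_smul, MemLp.toLp_eq_toLp_iff]
    filter_upwards [Lp.coeFn_smul c f] with x hx
    rw [hx]
    exact mul_left_comm _ _ _

/-- The constant function `1`. -/
def one : L2T := Lp.const 2 volume (1 : ℂ)

/-- `L₁ u = ν u'' - ν u - i (β/ν) sin y u`, with domain `H²`. -/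
def opL1 (ν β : ℝ) : L2T →ₗ.[ℂ] L2T where
  domain := H2
  toFun := (ν : ℂ) • secondDeriv - (ν : ℂ) • H2.subtype
    - (Complex.I * (β / ν : ℝ)) • (mulSin ∘ₗ H2.subtype)

/-- `L' = -ν k_f² ∂² + (i k₁ / k_f²) (γ/ν) sin y (1 - (b² - ∂²)⁻¹)` with
`b² = (k₁² + k₃²) / k_f²`, with domain `H²`. -/
def opL' (ν γ kf : ℝ) (k₁ k₃ : ℤ) : L2T →ₗ.[ℂ] L2T where
  domain := H2
  toFun := -((ν * kf ^ 2 : ℝ) : ℂ) • secondDeriv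
    + (Complex.I * (k₁ / kf ^ 2 * (γ / ν) : ℝ)) •
      (mulSin ∘ₗ (LinearMap.id - helmholtzInv (((k₁ : ℝ) ^ 2 + (k₃ : ℝ) ^ 2) / kf ^ 2)) ∘ₗ
        H2.subtype)

/-- The space `X = L²₀` of square integrable functions with mean zero. -/
def meanZero : Submodule ℂ L2T where
  carrier := {f | ∫ y : Torus, f y = 0}
  add_mem' := by
    intro f g hf hg
    have hi : ∀ f : L2T, Integrable (f : Torus → ℂ) := fun f =>
      (Lp.memLp f).integrable (by norm_num)
    change ∫ y : Torus, (f + g : L2T) y = 0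
    rw [integral_congr_ae (Lp.coeFn_add f g)]
    simp only [Pi.add_apply]
    rw [integral_add (hi f) (hi g)]
    rw [Set.mem_ofPred_eq] at hf hg
    rw [hf, hg, add_zero]
  zero_mem' := by
    change ∫ y : Torus, (0 : L2T) y = 0
    rw [integral_congr_ae (Lp.coeFn_zero _ _ _)]
    simp
  smul_mem' := by
    intro c f hf
    change ∫ y : Torus, (c • f : L2T) y = 0
    rw [integral_congr_ae (Lp.coeFn_smul c f)]
    simp only [Pi.smul_apply]
    rw [integral_smul]
    rw [Set.mem_ofPred_eq] at hf
    rw [hf, smul_zero]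

theorem meanZero_eq : meanZero = (Submodule.span ℂ {one})ᗮ := by
  ext f
  rw [Submodule.mem_orthogonal_singleton_iff_inner_right, L2.inner_def]
  have h : ∫ y : Torus, inner ℂ (one y) (f y) = ∫ y : Torus, f y := by
    refine integral_congr_ae ?_
    filter_upwards [Lp.coeFn_const 2 (volume : Measure Torus) (1 : ℂ)] with y hy
    rw [one, hy]
    simp
  rw [h]
  rfl

instance hasOrthogonalProjection_meanZero : meanZero.HasOrthogonalProjection := by
  rw [meanZero_eq]
  infer_instance

/-- The orthogonal projection `Q₁` of `L²` onto `X`. -/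
def Q1 : L2T →ₗ[ℂ] meanZero := (meanZero.orthogonalProjectionOnto : L2T →L[ℂ] meanZero)

/-- The operator `Q₁ L'` in `X`, with domain `H² ∩ X`. -/
def opQ1L' (ν γ kf : ℝ) (k₁ k₃ : ℤ) : meanZero →ₗ.[ℂ] meanZero where
  domain := H2.comap meanZero.subtype
  toFun := Q1 ∘ₗ (opL' ν γ kf k₁ k₃).toFun ∘ₗ
    (meanZero.subtype.restrict (p := H2.comap meanZero.subtype) (q := H2) fun _ hf => hf)

/-- The norm `‖f‖_* = ⟨f, f - (1 - ∂²)⁻¹ f⟩^{1/2}` on `X`. -/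
def starNorm (f : meanZero) : ℝ :=
  Real.sqrt (inner ℂ (f : L2T) ((f : L2T) - helmholtzInv 1 (f : L2T))).re

/-- `Ψ(H) = inf {‖(H - iμ) f‖ ; f ∈ D(H), μ ∈ ℝ, ‖f‖ = 1}`, for the norm `N`. -/
def pseudospectralBound {E : Type*} [AddCommGroup E] [Module ℂ E] (N : E → ℝ)
    (H : E →ₗ.[ℂ] E) : ℝ :=
  sInf {r : ℝ | ∃ (f : H.domain) (μ : ℝ),
    N (f : E) = 1 ∧ r = N (H f - (Complex.I * (μ : ℂ)) • (f : E))}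

/-- The bounded operator `T` is the inverse of the (unbounded) operator `H`. -/
def IsBoundedInverse {E : Type*} [NormedAddCommGroup E] [NormedSpace ℂ E] (H : E →ₗ.[ℂ] E)
    (T : E →L[ℂ] E) : Prop :=
  (∀ u : H.domain, T (H u) = u) ∧ ∀ f : E, ∃ h : T f ∈ H.domain, H ⟨T f, h⟩ = f

end KolmogorovFlow

end

noncomputable section

namespace KolmogorovFlow

/-! ### Resolvent bounds from commutators -/

/-! Everything is energy estimates in `L²`, with integration by parts carried out on Fourier
coefficients.

Pseudospectral bound. Put `K = (1 - (1 - ∂²)⁻¹)^{1/2}` and `α = k₁γ`. As `K` commutes with `∂` and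
kills constants, `g = K u` turns the star norm into the `L²` norm and removes `Q1`; up to the factor
`ν` the problem becomes `-g'' + iβ(S - μ)g = y` with `S = ±2 K sin K` and `β = |α|/(2ν²)`. One needs
`‖y‖ ≥ c √β ‖g‖`, the scaling of a mode of width `β^{-1/4}` at a critical point of the sine. With `C
= ±2 K cos K` one still has `[∂, S] = C` and `[∂, C] = -S`, but `S` and `C` no longer commute: `P =
∂[C, S]` is a nonnegative Fourier multiplier, and off the zero mode `S² + C²` falls short of `4` by
at most `4P`. `IsSinCosPair` records these relations. Pairing the equation with `g`, `(S - μ)g` and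
`g''` bounds the shifted operator and the derivatives (`sq_norm_deriv_le`, `sq_norm_shift_le`,
`sq_norm_deriv_deriv_le`). The virial identity for `C∂ + ∂C` (`virial_le`) then makes `Cg` and `⟨Pg,
g⟩` small. But `sq_norm_sin_le` controls `Sg` by `Cg` and `g'`, so `S² + C² + 4P ≥ 4` fails: this is
`rescaled_system_false`.

Inverse of `L₁`. Dividing by `ν` gives `u'' - u - ib sin y u = f` with `b = β/ν²`. Writing `R = (1 -
∂²)^{-1/2}`, solvability reduces to inverting `1 + ibR sin R`, where `R sin R` is self-adjoint
(`isUnit_one_add_smul`). Pairings with `u` and `sin y u`, together with an uncertainty inequality at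
the zeros of the sine, give `‖u‖ ≲ |b|^{-2/3}‖f‖` and `‖sin y u‖ ≲ |b|^{-1}‖f‖` (`energy_system`). A
weighted Cauchy–Schwarz inequality at width `|b|^{-1/3}` yields the `L¹` bound.

Lower bound. For `f = 1` the real part of the energy identity reads `-Re⟨u, 1⟩ = ‖u‖² + ‖u'‖²`.
Testing the equation with a bump of width `|b|^{-1/3}` at a zero of the sine bounds this energy
below (`energy_ge`). -/

/-- The relations between differentiation (given by its graph `D`) and a pair of bounded
symmetric operators that behave like the multiplications by `2 sin` and `2 cos`. -/
structure IsSinCosPair {E : Type*} [NormedAddCommGroup E] [InnerProductSpace ℂ E]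
    (D : Submodule ℂ (E × E)) (S C P : E →ₗ[ℂ] E) : Prop where
  inner_deriv : ∀ {x x' y y' : E}, (x, x') ∈ D → (y, y') ∈ D → inner ℂ x' y = -inner ℂ x y'
  deriv_sin : ∀ {x x' : E}, (x, x') ∈ D → (S x, S x' + C x) ∈ D
  deriv_cos : ∀ {x x' : E}, (x, x') ∈ D → (C x, C x' - S x) ∈ D
  sin_symm : S.IsSymmetric
  cos_symm : C.IsSymmetric
  deriv_comm : ∀ x, (C (S x) - S (C x), P x) ∈ D
  comm_nonneg : ∀ x, 0 ≤ (inner ℂ (P x) x).re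
  sq_add_sq_le : ∀ x, ‖S x‖ ^ 2 + ‖C x‖ ^ 2 ≤ 4 * ‖x‖ ^ 2

namespace IsSinCosPair

variable {E : Type*} [NormedAddCommGroup E] [InnerProductSpace ℂ E]
  {D : Submodule ℂ (E × E)} {S C P : E →ₗ[ℂ] E}

theorem neg (h : IsSinCosPair D S C P) : IsSinCosPair D (-S) (-C) P where
  inner_deriv := h.inner_deriv
  deriv_sin hx := by
    have := D.neg_mem (h.deriv_sin hx)
    simpa [add_comm] using this
  deriv_cos hx := by
    have := D.neg_mem (h.deriv_cos hx)
    simpa [sub_eq_add_neg, add_comm] using this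
  sin_symm := fun x y => by simpa using h.sin_symm x y
  cos_symm := fun x y => by simpa using h.cos_symm x y
  deriv_comm x := by simpa using h.deriv_comm x
  comm_nonneg := h.comm_nonneg
  sq_add_sq_le x := by simpa using h.sq_add_sq_le x

theorem norm_sin_le (h : IsSinCosPair D S C P) (x : E) : ‖S x‖ ≤ 2 * ‖x‖ := by
  refine le_of_sq_le_sq ?_ (by positivity)
  nlinarith [h.sq_add_sq_le x, sq_nonneg ‖C x‖]

end IsSinCosPair

theorem abs_re_inner_le {E : Type*} [NormedAddCommGroup E] [InnerProductSpace ℂ E] (x y : E) :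
    |(inner ℂ x y).re| ≤ ‖x‖ * ‖y‖ :=
  (Complex.abs_re_le_norm _).trans (norm_inner_le_norm x y)

theorem abs_im_inner_le {E : Type*} [NormedAddCommGroup E] [InnerProductSpace ℂ E] (x y : E) :
    |(inner ℂ x y).im| ≤ ‖x‖ * ‖y‖ :=
  (Complex.abs_im_le_norm _).trans (norm_inner_le_norm x y)

theorem re_inner_comm {E : Type*} [NormedAddCommGroup E] [InnerProductSpace ℂ E] (x y : E) :
    (inner ℂ x y).re = (inner ℂ y x).re := by
  rw [← inner_conj_symm, Complex.conj_re]

theorem im_inner_comm {E : Type*} [NormedAddCommGroup E] [InnerProductSpace ℂ E] (x y : E) :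
    (inner ℂ x y).im = -(inner ℂ y x).im := by
  rw [← inner_conj_symm, Complex.conj_im]

theorem re_inner_self {E : Type*} [NormedAddCommGroup E] [InnerProductSpace ℂ E] (x : E) :
    (inner ℂ x x).re = ‖x‖ ^ 2 := by
  rw [inner_self_eq_norm_sq_to_K]
  norm_cast

theorem im_ofReal_sq (r : ℝ) : ((r : ℂ) ^ 2).im = 0 := by
  norm_cast

theorem im_inner_symmetric {E : Type*} [NormedAddCommGroup E] [InnerProductSpace ℂ E]
    {S : E →ₗ[ℂ] E} (hS : S.IsSymmetric) (x : E) : (inner ℂ (S x) x).im = 0 := by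
  have h1 := im_inner_comm (S x) x
  rw [hS x x] at h1 ⊢
  have h2 := im_inner_comm x (S x)
  have h3 := congrArg Complex.im (hS x x)
  linarith

/-- The system of inequalities satisfied by the rescaled norms has no solution. -/
theorem rescaled_system_false {e v θ p s w σ : ℝ} (he : 0 < e) (he' : e ≤ 1 / 32)
    (hv : 0 ≤ v) (hve : v ≤ e ^ 2) (hθ : 0 ≤ θ) (hp : 0 ≤ p) (hs : 0 ≤ s) (hσ : 0 ≤ σ)
    (h2 : s ^ 2 ≤ e ^ 4 * s + v * θ) (h3 : w ^ 2 ≤ e ^ 4 * w + v * θ)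
    (h5 : θ ^ 2 + p ≤ 2 * s * (σ + 1))
    (h4 : σ ^ 2 ≤ v ^ 2 * (θ ^ 2 + 4 * p + 4 * s) + s * (4 * w + σ) + 4 * v * θ)
    (h6 : 4 ≤ 2 * θ ^ 2 + 4 * v * θ + 3 * p) : False := by
  -- The argument bootstraps on `r`: the estimates give `s, w ≲ e r` and `σ ≲ e r²`, hence `θ² + p ≲
  -- e r³`. For small `e` this forces `r = 1`.
  obtain ⟨r, hr1, hr4⟩ : ∃ r : ℝ, 1 ≤ r ∧ r ^ 4 = max 1 (θ ^ 2 + p) := by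
    refine ⟨√√(max 1 (θ ^ 2 + p)), ?_, ?_⟩
    · rw [Real.one_le_sqrt, Real.one_le_sqrt]
      exact le_max_left _ _
    · have : ∀ a : ℝ, a ^ 4 = (a ^ 2) ^ 2 := fun a => by ring
      rw [this, Real.sq_sqrt (Real.sqrt_nonneg _), Real.sq_sqrt]
      positivity
  have hX : θ ^ 2 + p ≤ r ^ 4 := hr4 ▸ le_max_right _ _
  have hr0 : 0 < r := by linarith
  have hθr : θ ≤ r ^ 2 := by
    refine le_of_sq_le_sq ?_ (by positivity)
    nlinarith
  have hvθ : v * θ ≤ (e * r) ^ 2 := by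
    calc v * θ ≤ e ^ 2 * r ^ 2 := by gcongr
      _ = _ := by ring
  have hee : e ^ 4 ≤ e := by
    have : e ^ 3 ≤ 1 := pow_le_one₀ he.le (by linarith)
    nlinarith
  have her : e ≤ e * r := by nlinarith
  have aux : ∀ t : ℝ, t ^ 2 ≤ e ^ 4 * t + v * θ → t ≤ 2 * (e * r) := by
    intro t ht
    by_contra! hlt
    have ht0 : 0 < t := lt_trans (by positivity) hlt
    nlinarith [mul_le_mul_of_nonneg_right hee ht0.le, mul_pos he hr0]
  have hs2 := aux s h2
  have hw2 := aux w h3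
  have hr24 : r ^ 2 ≤ r ^ 4 := pow_le_pow_right₀ hr1 (by norm_num)
  have hr14 : r ≤ r ^ 4 := by simpa using pow_le_pow_right₀ hr1 (show 1 ≤ 4 by norm_num)
  have hr12 : r ≤ r ^ 2 := by simpa using pow_le_pow_right₀ hr1 (show 1 ≤ 2 by norm_num)
  have hσr : σ ≤ 8 * (e * r ^ 2) := by
    have hv2 : v ^ 2 ≤ e ^ 2 := by
      have : v ≤ e := hve.trans (by nlinarith)
      gcongr
    have hs3 : s ≤ r ^ 4 := by
      have : e * r ≤ 1 / 32 * r := by gcongr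
      linarith
    have t1 : v ^ 2 * (θ ^ 2 + 4 * p + 4 * s) ≤ e ^ 2 * (8 * r ^ 4) := by
      gcongr
      nlinarith
    have t2 : s * (4 * w + σ) ≤ 2 * (e * r) * (8 * (e * r) + σ) := by
      have : 4 * w + σ ≤ 8 * (e * r) + σ := by linarith
      calc s * (4 * w + σ) ≤ s * (8 * (e * r) + σ) := by gcongr
        _ ≤ _ := by gcongr
    by_contra! hlt
    have hb : 0 < e * r ^ 2 := by positivity
    have hσ0 : 0 < σ := lt_trans (by positivity) hlt
    have t3 : (e * r) ^ 2 ≤ e ^ 2 * r ^ 4 := by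
      rw [mul_pow]
      gcongr
    have t4 : e * r * σ ≤ e * r ^ 2 * σ := by gcongr
    have t5 : e * r ^ 2 * σ ≤ σ ^ 2 / 8 := by
      have := mul_lt_mul_of_pos_right hlt hσ0
      linarith
    have t6 : e ^ 2 * r ^ 4 ≤ σ ^ 2 / 64 := by
      have := pow_le_pow_left₀ (by positivity) hlt.le 2
      linarith
    have hσ2 : 0 < σ ^ 2 := by positivity
    linarith
  have hX2 : θ ^ 2 + p ≤ r ^ 4 / 4 := by
    have h1 : σ + 1 ≤ 2 * r ^ 2 := by
      have : e * r ^ 2 ≤ 1 / 32 * r ^ 2 := by gcongr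
      linarith
    calc θ ^ 2 + p ≤ 2 * s * (σ + 1) := h5
      _ ≤ 2 * (2 * (e * r)) * (2 * r ^ 2) := by gcongr
      _ = 8 * e * r ^ 3 := by ring
      _ ≤ 8 * (1 / 32) * r ^ 4 := by
        gcongr
        norm_num
      _ = _ := by ring
  -- The maximum cannot be `θ² + p ≤ r⁴/4`, so it is `1`; then `θ² + p ≤ 1/4`, which contradicts
  -- `h6`.
  have hr41 : r ^ 4 = 1 := by
    rcases max_choice 1 (θ ^ 2 + p) with h | h
    · rw [hr4, h]
    · have : 0 < r ^ 4 := by positivity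
      rw [h] at hr4
      linarith
  have hv1 : v ≤ 1 := hve.trans (by nlinarith)
  nlinarith [mul_nonneg (sub_nonneg.2 hv1) hθ, sq_nonneg (θ - 1)]

/-! ### Energy, commutator and virial inequalities for a sine–cosine pair -/

namespace IsSinCosPair

variable {E : Type*} [NormedAddCommGroup E] [InnerProductSpace ℂ E]
  {D : Submodule ℂ (E × E)} {S C P : E →ₗ[ℂ] E}

theorem deriv_shift (h : IsSinCosPair D S C P) {x x' : E} (hx : (x, x') ∈ D) (μ : ℂ) :
    (S x - μ • x, S x' + C x - μ • x') ∈ D := by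
  simpa using D.sub_mem (h.deriv_sin hx) (D.smul_mem μ hx)

theorem norm_sq_sub_smul (_ : IsSinCosPair D S C P) (x : E) (μ : ℝ) :
    ‖S x - (μ : ℂ) • x‖ ^ 2 = ‖S x‖ ^ 2 - 2 * μ * (inner ℂ (S x) x).re + μ ^ 2 * ‖x‖ ^ 2 := by
  rw [← re_inner_self, ← re_inner_self, ← re_inner_self]
  simp only [inner_sub_left, inner_sub_right, inner_smul_left, inner_smul_right,
    Complex.conj_ofReal, Complex.sub_re, Complex.re_ofReal_mul]
  rw [re_inner_comm x (S x)]
  ring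

/-- Spectral parameters outside `[-2, 2]` may be moved to the boundary. -/
theorem exists_clamp (h : IsSinCosPair D S C P) (x : E) (μ : ℝ) :
    ∃ μ₀ : ℝ, |μ₀| ≤ 2 ∧ ‖S x - (μ₀ : ℂ) • x‖ ≤ ‖S x - (μ : ℂ) • x‖ := by
  have hb : |(inner ℂ (S x) x).re| ≤ 2 * ‖x‖ ^ 2 := by
    refine (abs_re_inner_le _ _).trans ?_
    nlinarith [h.norm_sin_le x, norm_nonneg x]
  rw [abs_le] at hb
  have key : ∀ μ₀ : ℝ, 0 ≤ (μ - μ₀) * ((μ + μ₀) * ‖x‖ ^ 2 - 2 * (inner ℂ (S x) x).re) →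
      ‖S x - (μ₀ : ℂ) • x‖ ≤ ‖S x - (μ : ℂ) • x‖ := by
    intro μ₀ h0
    refine le_of_sq_le_sq ?_ (norm_nonneg _)
    rw [h.norm_sq_sub_smul, h.norm_sq_sub_smul]
    linarith
  rcases le_total |μ| 2 with h1 | h1
  · exact ⟨μ, h1, le_rfl⟩
  rcases le_total 0 μ with h2 | h2
  · rw [abs_of_nonneg h2] at h1
    refine ⟨2, by norm_num, key 2 (mul_nonneg (by linarith) ?_)⟩
    nlinarith [sq_nonneg ‖x‖]
  · rw [abs_of_nonpos h2] at h1
    refine ⟨-2, by norm_num, key (-2) (mul_nonneg_of_nonpos_of_nonpos (by linarith) ?_)⟩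
    nlinarith [sq_nonneg ‖x‖]

variable {g g₁ g₂ y : E} {β μ : ℝ}

/-- Real part of `⟨g, y⟩`: the skew term drops out because `S` is symmetric and `μ` is real. -/
theorem sq_norm_deriv_le (h : IsSinCosPair D S C P) (h1 : (g, g₁) ∈ D) (h2 : (g₁, g₂) ∈ D)
    (hy : y = -g₂ + (Complex.I * β) • (S g - (μ : ℂ) • g)) : ‖g₁‖ ^ 2 ≤ ‖y‖ * ‖g‖ := by
  have e1 : inner ℂ g g₂ = -inner ℂ g₁ g₁ := by rw [h.inner_deriv h1 h2, neg_neg]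
  have e2 : (inner ℂ g y).re = ‖g₁‖ ^ 2 := by
    rw [hy, ← re_inner_self]
    simp only [inner_add_right, inner_neg_right, inner_sub_right, inner_smul_right, e1]
    have h3 := im_inner_symmetric h.sin_symm g
    rw [h.sin_symm g g] at h3
    simp [h3, im_ofReal_sq]
  rw [← e2, re_inner_comm]
  exact (le_abs_self _).trans (abs_re_inner_le y g)

/-- Imaginary part of `⟨z, y⟩` with `z = (S - μ)g`. In `⟨z', g'⟩` the part `⟨(S - μ)g', g'⟩` is
real, so only the commutator term `⟨Cg, g'⟩` survives. -/
theorem sq_norm_shift_le (h : IsSinCosPair D S C P) (h1 : (g, g₁) ∈ D) (h2 : (g₁, g₂) ∈ D)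
    (hy : y = -g₂ + (Complex.I * β) • (S g - (μ : ℂ) • g)) :
    β * ‖S g - (μ : ℂ) • g‖ ^ 2 ≤ ‖y‖ * ‖S g - (μ : ℂ) • g‖ + ‖C g‖ * ‖g₁‖ := by
  have hz := h.deriv_shift h1 μ
  set z := S g - (μ : ℂ) • g with hzd
  have e1 : inner ℂ z g₂ = -inner ℂ (S g₁ + C g - (μ : ℂ) • g₁) g₁ := by
    rw [h.inner_deriv hz h2, neg_neg]
  have e2 : (inner ℂ z y).im = (inner ℂ (C g) g₁).im + β * ‖z‖ ^ 2 := by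
    rw [hy, ← re_inner_self z]
    simp only [inner_add_right, inner_neg_right, inner_smul_right, e1, inner_add_left,
      inner_sub_left, inner_smul_left, Complex.conj_ofReal]
    simp [im_inner_symmetric h.sin_symm g₁, im_ofReal_sq]
  have e3 := (le_abs_self _).trans (abs_im_inner_le z y)
  have e4 := (neg_le_abs _).trans (abs_im_inner_le (C g) g₁)
  linarith

/-- Real part of `⟨g'', y⟩`, with the same cross term `⟨Cg, g'⟩`, now weighted by `β`. -/
theorem sq_norm_deriv_deriv_le (h : IsSinCosPair D S C P) (h1 : (g, g₁) ∈ D) (h2 : (g₁, g₂) ∈ D)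
    (hβ : 0 < β) (hy : y = -g₂ + (Complex.I * β) • (S g - (μ : ℂ) • g)) :
    ‖g₂‖ ^ 2 ≤ ‖y‖ * ‖g₂‖ + β * (‖C g‖ * ‖g₁‖) := by
  have hz := h.deriv_shift h1 μ
  set z := S g - (μ : ℂ) • g with hzd
  have e1 : inner ℂ z g₂ = -inner ℂ (S g₁ + C g - (μ : ℂ) • g₁) g₁ := by
    rw [h.inner_deriv hz h2, neg_neg]
  have e2 : (inner ℂ g₂ y).re = -‖g₂‖ ^ 2 - β * (inner ℂ (C g) g₁).im := by
    rw [hy, ← re_inner_self g₂]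
    have e0 : (inner ℂ g₂ z).im = (inner ℂ (C g) g₁).im := by
      rw [im_inner_comm, e1]
      simp [
        im_inner_symmetric h.sin_symm g₁, im_ofReal_sq]
    simp only [inner_add_right, inner_neg_right, inner_smul_right]
    simp [e0]
    ring
  have e3 := (neg_le_abs _).trans (abs_re_inner_le g₂ y)
  have e4 := (neg_le_abs _).trans (abs_im_inner_le (C g) g₁)
  nlinarith

/-- With the antisymmetric operator `A = C∂ + ∂C`, twice the real part of `⟨(S - μ₀)g, Ag⟩` is `⟨[S,
A]g, g⟩`, and `[S, A] = -2C² - 2P`. The sign of `P` is favourable. The equation for `g` plays no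
role. -/
theorem virial_le (h : IsSinCosPair D S C P) (h1 : (g, g₁) ∈ D) (μ₀ : ℝ) :
    ‖C g‖ ^ 2 + (inner ℂ (P g) g).re ≤ ‖S g - (μ₀ : ℂ) • g‖ * (2 * ‖C g₁‖ + 2 * ‖g‖) := by
  have hz := h.deriv_shift h1 μ₀
  set z := S g - (μ₀ : ℂ) • g with hzd
  have e1 := h.inner_deriv hz (h.deriv_cos h1)
  have e2 := h.inner_deriv (h.deriv_comm g) h1
  have e3 : (inner ℂ z (C g₁ - S g + C g₁)).re = -‖C g‖ ^ 2 - (inner ℂ (P g) g).re := by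
    rw [inner_add_right, ← neg_neg (inner ℂ z (C g₁ - S g)), ← e1, e2, ← h.cos_symm z g₁, hzd,
      ← re_inner_self]
    simp only [map_sub, map_smul, inner_add_left, inner_sub_left, inner_smul_left,
      Complex.conj_ofReal, Complex.add_re, Complex.sub_re, Complex.neg_re,
      Complex.re_ofReal_mul]
    rw [h.sin_symm g₁ (C g), h.cos_symm g g₁, re_inner_comm g₁ (C g), re_inner_comm g₁ (S (C g)),
      ← h.cos_symm g g₁]
    ring
  have e4 := (neg_le_abs _).trans (abs_re_inner_le z (C g₁ - S g + C g₁))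
  have e5 : ‖C g₁ - S g + C g₁‖ ≤ 2 * ‖C g₁‖ + 2 * ‖g‖ := by
    have t1 := norm_add_le (C g₁ - S g) (C g₁)
    have t2 := norm_sub_le (C g₁) (S g)
    linarith [h.norm_sin_le g]
  have e6 := mul_le_mul_of_nonneg_left e5 (norm_nonneg z)
  linarith

/-- An uncertainty principle: `g` cannot sit where `C` is small unless `g'` is large. It comes from
integrating by parts between `Sg` and `Cg`; commuting `C` past `S` costs `⟨Pg, g⟩`. -/
theorem sq_norm_sin_le (h : IsSinCosPair D S C P) (h1 : (g, g₁) ∈ D) :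
    ‖S g‖ ^ 2 + (inner ℂ (P g) g).re ≤ ‖C g‖ ^ 2 + 4 * (‖C g‖ * ‖g₁‖) := by
  have e1 := h.inner_deriv (h.deriv_sin h1) (h.deriv_cos h1)
  have e2 := h.inner_deriv (h.deriv_comm g) h1
  have e3 : ‖S g‖ ^ 2 = ‖C g‖ ^ 2 - (inner ℂ (P g) g).re + 2 * (inner ℂ (C g) (S g₁)).re := by
    rw [inner_sub_right] at e1
    rw [e2, ← re_inner_self (S g), ← re_inner_self (C g)]
    have e4 : inner ℂ (S g) (S g) = inner ℂ (S g₁ + C g) (C g) + inner ℂ (S g) (C g₁) := by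
      rw [e1]; ring
    rw [e4, ← h.cos_symm (S g) g₁]
    simp only [inner_add_left, inner_sub_left, Complex.add_re, Complex.neg_re, Complex.sub_re]
    rw [re_inner_comm (S g₁) (C g), h.sin_symm (C g) g₁]
    ring
  have e4 := (le_abs_self _).trans (abs_re_inner_le (C g) (S g₁))
  have e5 := mul_le_mul_of_nonneg_left (h.norm_sin_le g₁) (norm_nonneg (C g))
  linarith

/-- By `S² + C² ≤ 4` it suffices to bound `‖Sg'‖² - μ₀²‖g'‖²` from below. This is `Re⟨(S - μ₀)g', (S
+ μ₀)g'⟩`, where `(S - μ₀)g'` is the derivative of `(S - μ₀)g` minus `Cg`, so the derivative can be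
moved to the other factor. -/
theorem sq_norm_cos_deriv_le (h : IsSinCosPair D S C P) (h1 : (g, g₁) ∈ D) (h2 : (g₁, g₂) ∈ D)
    {μ₀ : ℝ} (hμ₀ : |μ₀| ≤ 2) :
    ‖C g₁‖ ^ 2 ≤ (4 - μ₀ ^ 2) * ‖g₁‖ ^ 2 +
      ‖S g - (μ₀ : ℂ) • g‖ * (4 * ‖g₂‖ + ‖C g₁‖) + 4 * (‖C g‖ * ‖g₁‖) := by
  have hz := h.deriv_shift h1 μ₀
  have hw : (S g₁ + (μ₀ : ℂ) • g₁, S g₂ + C g₁ + (μ₀ : ℂ) • g₂) ∈ D := by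
    simpa using D.add_mem (h.deriv_sin h2) (D.smul_mem (μ₀ : ℂ) h2)
  set z := S g - (μ₀ : ℂ) • g with hzd
  have hbd : ∀ x : E, ‖S x + (μ₀ : ℂ) • x‖ ≤ 4 * ‖x‖ := by
    intro x
    have t1 := norm_add_le (S x) ((μ₀ : ℂ) • x)
    rw [norm_smul, Complex.norm_real, Real.norm_eq_abs] at t1
    nlinarith [h.norm_sin_le x, norm_nonneg x]
  have e1 := h.inner_deriv hz hw
  have e2 : ‖S g₁‖ ^ 2 - μ₀ ^ 2 * ‖g₁‖ ^ 2 =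
      -(inner ℂ z (S g₂ + C g₁ + (μ₀ : ℂ) • g₂)).re -
        (inner ℂ (C g) (S g₁ + (μ₀ : ℂ) • g₁)).re := by
    rw [← Complex.neg_re, ← e1, ← re_inner_self, ← re_inner_self]
    simp only [inner_add_left, inner_add_right, inner_sub_left, inner_smul_left, inner_smul_right,
      Complex.conj_ofReal, Complex.add_re, Complex.sub_re, Complex.re_ofReal_mul]
    rw [re_inner_comm g₁ (S g₁)]
    ring
  have e3 := (le_abs_self _).trans (abs_re_inner_le z (S g₂ + C g₁ + (μ₀ : ℂ) • g₂))
  have e4 := (le_abs_self _).trans (abs_re_inner_le (C g) (S g₁ + (μ₀ : ℂ) • g₁))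
  have e5 : ‖S g₂ + C g₁ + (μ₀ : ℂ) • g₂‖ ≤ 4 * ‖g₂‖ + ‖C g₁‖ := by
    have t1 : S g₂ + C g₁ + (μ₀ : ℂ) • g₂ = (S g₂ + (μ₀ : ℂ) • g₂) + C g₁ := by abel
    rw [t1]
    exact (norm_add_le _ _).trans (add_le_add_left (hbd g₂) _)
  have e6 := mul_le_mul_of_nonneg_left e5 (norm_nonneg z)
  have e7 := mul_le_mul_of_nonneg_left (hbd g₁) (norm_nonneg (C g))
  linarith [h.sq_add_sq_le g₁]

/-- Shows that `4 - μ₀²` is itself small, so that its product with `‖g'‖²` in `sq_norm_cos_deriv_le`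
can be absorbed. It rests on `S² - μ₀² = (S - μ₀)(S + μ₀)` in quadratic form. -/
theorem gap_le (h : IsSinCosPair D S C P) {μ₀ : ℝ} (hμ₀ : |μ₀| ≤ 2)
    (hlow : 4 * ‖g‖ ^ 2 ≤ ‖S g‖ ^ 2 + ‖C g‖ ^ 2 + 4 * (inner ℂ (P g) g).re) :
    (4 - μ₀ ^ 2) * ‖g‖ ^ 2 ≤
      ‖C g‖ ^ 2 + 4 * (inner ℂ (P g) g).re + 4 * (‖S g - (μ₀ : ℂ) • g‖ * ‖g‖) := by
  have hbd : ‖S g + (μ₀ : ℂ) • g‖ ≤ 4 * ‖g‖ := by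
    have t1 := norm_add_le (S g) ((μ₀ : ℂ) • g)
    rw [norm_smul, Complex.norm_real, Real.norm_eq_abs] at t1
    nlinarith [h.norm_sin_le g, norm_nonneg g]
  have e2 : ‖S g‖ ^ 2 - μ₀ ^ 2 * ‖g‖ ^ 2 =
      (inner ℂ (S g - (μ₀ : ℂ) • g) (S g + (μ₀ : ℂ) • g)).re := by
    rw [← re_inner_self, ← re_inner_self]
    simp only [inner_add_right, inner_sub_left, inner_smul_left, inner_smul_right,
      Complex.conj_ofReal, Complex.add_re, Complex.sub_re, Complex.re_ofReal_mul]
    rw [re_inner_comm g (S g)]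
    ring
  have e3 := (le_abs_self _).trans
    (abs_re_inner_le (S g - (μ₀ : ℂ) • g) (S g + (μ₀ : ℂ) • g))
  have e4 := mul_le_mul_of_nonneg_left hbd (norm_nonneg (S g - (μ₀ : ℂ) • g))
  linarith

theorem norm_ge_of_norm_eq_one (h : IsSinCosPair D S C P) (h1 : (g, g₁) ∈ D) (h2 : (g₁, g₂) ∈ D)
    (hβ : 0 < β) (hy : y = -g₂ + (Complex.I * β) • (S g - (μ : ℂ) • g))
    (hlow : 4 * ‖g‖ ^ 2 ≤ ‖S g‖ ^ 2 + ‖C g‖ ^ 2 + 4 * (inner ℂ (P g) g).re)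
    (hgap : ‖g‖ ≤ ‖g₁‖) (hg : ‖g‖ = 1) :
    (1 / 32) ^ 4 * √β ≤ ‖y‖ := by
  obtain ⟨μ₀, hμ₀, hle⟩ := h.exists_clamp g μ
  have i1 := h.sq_norm_deriv_le h1 h2 hy
  have i2 := h.sq_norm_shift_le h1 h2 hy
  have i3 := h.sq_norm_deriv_deriv_le h1 h2 hβ hy
  have i5 := h.virial_le h1 μ₀
  have i4 := h.sq_norm_cos_deriv_le h1 h2 hμ₀
  have i4' := h.gap_le hμ₀ hlow
  have i6 := h.sq_norm_sin_le h1
  have hP := h.comm_nonneg g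
  simp only [hg, mul_one, one_pow] at hlow hgap i1 i4' i5
  obtain ⟨M, hM0, hM2⟩ : ∃ M : ℝ, 0 < M ∧ √β = M ^ 2 :=
    ⟨√√β, by positivity, (Real.sq_sqrt (Real.sqrt_nonneg _)).symm⟩
  have hβM : β = M ^ 4 := by
    rw [← Real.sq_sqrt hβ.le, hM2]; ring
  -- For `β ≤ 1` the spectral gap `‖g‖ ≤ ‖g'‖` and the plain energy estimate already suffice.
  rcases le_total M 1 with hM1 | hM1
  · have : M ^ 2 ≤ 1 := pow_le_one₀ hM0.le hM1
    rw [hM2]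
    nlinarith
  by_contra! hlt
  rw [hM2] at hlt
  subst hβM
  set V := ‖g₁‖
  set z := ‖S g - (μ : ℂ) • g‖
  set s := ‖S g - (μ₀ : ℂ) • g‖
  set τ := ‖C g‖
  set W := ‖g₂‖
  set σ := ‖C g₁‖
  set p := (inner ℂ (P g) g).re
  set H := ‖y‖
  have hV : 0 ≤ V := norm_nonneg _
  have hτ : 0 ≤ τ := norm_nonneg _
  have hs : 0 ≤ s := norm_nonneg _
  have hz : 0 ≤ z := norm_nonneg _
  have hW : 0 ≤ W := norm_nonneg _
  have hσ : 0 ≤ σ := norm_nonneg _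
  have hH : 0 ≤ H := norm_nonneg _
  have hVe : V ≤ (1 / 32) ^ 2 * M := by
    refine le_of_sq_le_sq ?_ (by positivity)
    linarith
  -- The weights are those of a mode of width `1/M = β^{-1/4}` at a critical point: `g'` has size
  -- `M`, `g''` size `M²`, `Cg` size `1/M`, `(S - μ)g` and `⟨Pg, g⟩` size `M⁻²`, while `Cg'` has
  -- size `1`.
  refine rescaled_system_false (e := 1 / 32) (v := V / M) (θ := τ * M) (p := p * M ^ 2)
    (s := z * M ^ 2) (w := W / M ^ 2) (σ := σ) (by norm_num) le_rfl (by positivity)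
    (by rwa [div_le_iff₀ hM0]) (by positivity) (by positivity) (by positivity) hσ ?_ ?_ ?_ ?_ ?_
  · have e : V / M * (τ * M) = τ * V := by field_simp
    have : H * z ≤ (1 / 32) ^ 4 * M ^ 2 * z := by gcongr
    rw [e]
    linarith
  · have e : V / M * (τ * M) = τ * V := by field_simp
    have : H * W ≤ (1 / 32) ^ 4 * M ^ 2 * W := by gcongr
    rw [e, div_pow, div_le_iff₀ (by positivity)]
    have e2 : ((1 / 32) ^ 4 * (W / M ^ 2) + τ * V) * (M ^ 2) ^ 2 =
      (1 / 32) ^ 4 * M ^ 2 * W + M ^ 4 * (τ * V) := by field_simp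
    linarith
  · have : s * (2 * σ + 2) ≤ z * (2 * σ + 2) := by gcongr
    have := mul_le_mul_of_nonneg_right (i5.trans this) (sq_nonneg M)
    linarith
  · have t1 : (4 - μ₀ ^ 2) * V ^ 2 ≤ (τ ^ 2 + 4 * p + 4 * z) * V ^ 2 := by
      gcongr
      linarith
    have t2 : s * (4 * W + σ) ≤ z * (4 * W + σ) := by gcongr
    have t3 : z * σ ≤ z * M ^ 2 * σ := by
      have : z ≤ z * M ^ 2 := le_mul_of_one_le_right hz (one_le_pow₀ hM1)
      gcongr
    have e1 : (V / M) ^ 2 * ((τ * M) ^ 2 + 4 * (p * M ^ 2) + 4 * (z * M ^ 2)) =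
        (τ ^ 2 + 4 * p + 4 * z) * V ^ 2 := by field_simp
    have e2 : z * M ^ 2 * (4 * (W / M ^ 2) + σ) = 4 * (z * W) + z * M ^ 2 * σ := by field_simp
    have e3 : 4 * (V / M) * (τ * M) = 4 * (τ * V) := by field_simp
    rw [e1, e2, e3]
    linarith
  · have hM2 : 1 ≤ M ^ 2 := one_le_pow₀ hM1
    have t1 : τ ^ 2 ≤ (τ * M) ^ 2 := by
      rw [mul_pow]
      exact le_mul_of_one_le_right (sq_nonneg _) hM2
    have t2 : p ≤ p * M ^ 2 := le_mul_of_one_le_right hP hM2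
    have e3 : 4 * (V / M) * (τ * M) = 4 * (τ * V) := by field_simp
    rw [e3]
    linarith

theorem norm_ge (h : IsSinCosPair D S C P) (h1 : (g, g₁) ∈ D) (h2 : (g₁, g₂) ∈ D)
    (hβ : 0 < β) (hy : y = -g₂ + (Complex.I * β) • (S g - (μ : ℂ) • g))
    (hlow : 4 * ‖g‖ ^ 2 ≤ ‖S g‖ ^ 2 + ‖C g‖ ^ 2 + 4 * (inner ℂ (P g) g).re)
    (hgap : ‖g‖ ≤ ‖g₁‖) :
    (1 / 32) ^ 4 * √β * ‖g‖ ≤ ‖y‖ := by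
  rcases eq_or_ne g 0 with rfl | hg
  · simp
  have hg0 : 0 < ‖g‖ := norm_pos_iff.mpr hg
  obtain ⟨c, hc⟩ : ∃ c : ℝ, c = ‖g‖⁻¹ := ⟨_, rfl⟩
  have hc0 : 0 < c := hc ▸ inv_pos.mpr hg0
  have hn : ∀ x : E, ‖(c : ℂ) • x‖ = c * ‖x‖ := fun x => by
    rw [norm_smul, Complex.norm_real, Real.norm_of_nonneg hc0.le]
  have key := h.norm_ge_of_norm_eq_one (g := (c : ℂ) • g) (y := (c : ℂ) • y) (μ := μ)
    (D.smul_mem (c : ℂ) h1) (D.smul_mem (c : ℂ) h2) hβ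
    (by rw [hy, map_smul]; module)
    (by
      simp only [map_smul, hn, inner_smul_left, inner_smul_right, Complex.conj_ofReal,
        Complex.re_ofReal_mul]
      nlinarith [mul_le_mul_of_nonneg_left hlow (sq_nonneg c)])
    (by
      rw [hn, hn]
      gcongr)
    (by rw [hn, hc, inv_mul_cancel₀ hg0.ne'])
  rw [hn, hc, inv_mul_eq_div, le_div_iff₀ hg0] at key
  exact key

end IsSinCosPair

/-! ### Fourier coefficients and operators on the torus -/

theorem ext_inner_expL2 {f g : L2T} (h : ∀ n, inner ℂ (expL2 n) f = inner ℂ (expL2 n) g) :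
    f = g := by
  rw [← sub_eq_zero]
  exact eq_zero_of_inner_expL2 _ fun n => by rw [inner_sub_right, h, sub_self]

theorem hasSum_inner_expL2 (f g : L2T) :
    HasSum (fun n : ℤ => ((2 * Real.pi : ℝ) : ℂ)⁻¹ *
      (inner ℂ f (expL2 n) * inner ℂ (expL2 n) g)) (inner ℂ f g) := by
  have h := expBasis.hasSum_inner_mul_inner f g
  have h1 : (((Real.sqrt (2 * Real.pi))⁻¹ : ℝ) : ℂ) * (((Real.sqrt (2 * Real.pi))⁻¹ : ℝ) : ℂ) =
      ((2 * Real.pi : ℝ) : ℂ)⁻¹ := by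
    rw [← Complex.ofReal_mul, ← mul_inv, Real.mul_self_sqrt Real.two_pi_pos.le,
      Complex.ofReal_inv]
  have h2 : (fun n : ℤ => ((2 * Real.pi : ℝ) : ℂ)⁻¹ *
      (inner ℂ f (expL2 n) * inner ℂ (expL2 n) g)) =
      fun n => inner ℂ f (expBasis n) * inner ℂ (expBasis n) g := by
    ext n
    rw [inner_expBasis, expBasis_apply, inner_smul_right, ← h1]
    ring
  rw [h2]
  exact h

theorem inner_eq_of_coef {f g f' g' : L2T}
    (h : ∀ n, inner ℂ f (expL2 n) * inner ℂ (expL2 n) g =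
      inner ℂ f' (expL2 n) * inner ℂ (expL2 n) g') : inner ℂ f g = inner ℂ f' g' := by
  rw [← (hasSum_inner_expL2 f g).tsum_eq, ← (hasSum_inner_expL2 f' g').tsum_eq]
  exact tsum_congr fun n => by rw [h]

theorem hasSum_norm_sq (f : L2T) :
    HasSum (fun n : ℤ => (2 * Real.pi)⁻¹ * ‖inner ℂ (expL2 n) f‖ ^ 2) (‖f‖ ^ 2) := by
  have h := Complex.reCLM.hasSum (hasSum_inner_expL2 f f)
  convert h using 1
  · ext n
    rw [← inner_conj_symm f (expL2 n), ← Complex.normSq_eq_conj_mul_self, ← Complex.ofReal_inv,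
      ← Complex.ofReal_mul, Complex.reCLM_apply, Complex.ofReal_re, Complex.normSq_eq_norm_sq]
  · rw [Complex.reCLM_apply, re_inner_self]

theorem norm_le_of_coef {f g : L2T}
    (h : ∀ n, ‖inner ℂ (expL2 n) f‖ ≤ ‖inner ℂ (expL2 n) g‖) : ‖f‖ ≤ ‖g‖ := by
  refine le_of_sq_le_sq ?_ (norm_nonneg _)
  refine hasSum_le (fun n => ?_) (hasSum_norm_sq f) (hasSum_norm_sq g)
  have := h n
  gcongr

/-- The Fourier multiplier with bounded symbol `m`. -/
def multiplier (m : ℤ → ℂ) (K : ℝ) (hm : ∀ n, ‖m n‖ ≤ K) : L2T →ₗ[ℂ] L2T where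
  toFun f := (exists_multiplier m K hm f).choose
  map_add' f g := by
    refine ext_inner_expL2 fun n => ?_
    rw [inner_add_right, (exists_multiplier m K hm _).choose_spec,
      (exists_multiplier m K hm _).choose_spec, (exists_multiplier m K hm _).choose_spec,
      inner_add_right, mul_add]
  map_smul' c f := by
    refine ext_inner_expL2 fun n => ?_
    rw [RingHom.id_apply, inner_smul_right, (exists_multiplier m K hm _).choose_spec,
      (exists_multiplier m K hm _).choose_spec, inner_smul_right]
    ring

theorem inner_multiplier {m : ℤ → ℂ} {K : ℝ} (hm : ∀ n, ‖m n‖ ≤ K) (f : L2T) (n : ℤ) :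
    inner ℂ (expL2 n) (multiplier m K hm f) = m n * inner ℂ (expL2 n) f :=
  (exists_multiplier m K hm f).choose_spec n

theorem multiplier_symm {m : ℤ → ℝ} {K : ℝ} (hm : ∀ n, ‖(m n : ℂ)‖ ≤ K) :
    (multiplier (fun n => (m n : ℂ)) K hm).IsSymmetric := by
  intro f g
  refine inner_eq_of_coef fun n => ?_
  rw [← inner_conj_symm _ (expL2 n), inner_multiplier, inner_multiplier, map_mul,
    Complex.conj_ofReal, inner_conj_symm]
  ring

/-! ### Multiplication by sine and cosine on Fourier coefficients -/

/-- The cosine function on the torus. -/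
def cosT : Torus → ℝ := Real.cos_periodic.lift

theorem continuous_cosT : Continuous cosT := continuous_coinduced_dom.mpr Real.continuous_cos

theorem norm_cosT_le (x : Torus) : ‖(cosT x : ℂ)‖ ≤ 1 := by
  induction x using QuotientAddGroup.induction_on with
  | H y =>
    rw [Complex.norm_real]
    exact Real.abs_cos_le_one y

theorem memLp_cos_mul (f : L2T) :
    MemLp (fun x : Torus => (cosT x : ℂ) * f x) 2 volume := by
  have h : Continuous fun x : Torus => (cosT x : ℂ) :=
    Complex.continuous_ofReal.comp continuous_cosT
  refine (Lp.memLp f).of_le (h.aestronglyMeasurable.mul (Lp.aestronglyMeasurable f)) ?_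
  refine Filter.Eventually.of_forall fun x => ?_
  rw [norm_mul]
  exact mul_le_of_le_one_left (norm_nonneg _) (norm_cosT_le x)

/-- Multiplication by `cos y` on `L²`. -/
def mulCos : L2T →ₗ[ℂ] L2T where
  toFun f := (memLp_cos_mul f).toLp _
  map_add' f g := by
    rw [← MemLp.toLp_add, MemLp.toLp_eq_toLp_iff]
    filter_upwards [Lp.coeFn_add f g] with x hx
    rw [hx]
    exact mul_add _ _ _
  map_smul' c f := by
    rw [RingHom.id_apply, ← MemLp.toLp_const_smul, MemLp.toLp_eq_toLp_iff]
    filter_upwards [Lp.coeFn_smul c f] with x hx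
    rw [hx]
    exact mul_left_comm _ _ _

theorem coeFn_mulSin (f : L2T) : mulSin f =ᵐ[volume] fun x => (sinT x : ℂ) * f x :=
  (memLp_sin_mul f).coeFn_toLp

theorem coeFn_mulCos (f : L2T) : mulCos f =ᵐ[volume] fun x => (cosT x : ℂ) * f x :=
  (memLp_cos_mul f).coeFn_toLp

theorem mulSin_symm : mulSin.IsSymmetric := by
  intro f g
  rw [L2.inner_def, L2.inner_def]
  refine integral_congr_ae ?_
  filter_upwards [coeFn_mulSin f, coeFn_mulSin g] with x hf hg
  rw [hf, hg]
  simp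
  ring

theorem mulCos_symm : mulCos.IsSymmetric := by
  intro f g
  rw [L2.inner_def, L2.inner_def]
  refine integral_congr_ae ?_
  filter_upwards [coeFn_mulCos f, coeFn_mulCos g] with x hf hg
  rw [hf, hg]
  simp
  ring

theorem fourier_one_coe (y : ℝ) : (fourier 1 (y : Torus) : ℂ) = Complex.exp (y * Complex.I) := by
  rw [fourier_coe_apply]
  have : (Real.pi : ℂ) ≠ 0 := Complex.ofReal_ne_zero.mpr Real.pi_pos.ne'
  congr 1
  push_cast
  field_simp

theorem fourier_neg_one_coe (y : ℝ) :
    (fourier (-1) (y : Torus) : ℂ) = Complex.exp (-y * Complex.I) := by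
  rw [fourier_coe_apply]
  have : (Real.pi : ℂ) ≠ 0 := Complex.ofReal_ne_zero.mpr Real.pi_pos.ne'
  congr 1
  push_cast
  field_simp

theorem sinT_mul_fourier (n : ℤ) (x : Torus) :
    (sinT x : ℂ) * fourier n x =
      (-Complex.I / 2) * (fourier (n + 1) x - fourier (n - 1) x) := by
  rw [sub_eq_add_neg n 1, fourier_add, fourier_add]
  induction x using QuotientAddGroup.induction_on with
  | H y =>
    have h : (sinT (y : Torus) : ℂ) = Complex.sin y := Complex.ofReal_sin y
    have h1 := fourier_one_coe y
    have h2 := fourier_neg_one_coe y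
    change (sinT (y : Torus) : ℂ) * fourier n (y : Torus) = (-Complex.I / 2) *
      (fourier n (y : Torus) * fourier 1 (y : Torus) -
        fourier n (y : Torus) * fourier (-1) (y : Torus))
    rw [h, h1, h2, Complex.sin]
    ring

theorem cosT_mul_fourier (n : ℤ) (x : Torus) :
    (cosT x : ℂ) * fourier n x = (1 / 2) * (fourier (n + 1) x + fourier (n - 1) x) := by
  rw [sub_eq_add_neg n 1, fourier_add, fourier_add]
  induction x using QuotientAddGroup.induction_on with
  | H y =>
    have h : (cosT (y : Torus) : ℂ) = Complex.cos y := Complex.ofReal_cos y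
    have h1 := fourier_one_coe y
    have h2 := fourier_neg_one_coe y
    change (cosT (y : Torus) : ℂ) * fourier n (y : Torus) = (1 / 2) *
      (fourier n (y : Torus) * fourier 1 (y : Torus) +
        fourier n (y : Torus) * fourier (-1) (y : Torus))
    rw [h, h1, h2, Complex.cos]
    ring

theorem coeFn_expL2 (n : ℤ) : expL2 n =ᵐ[volume] (fourier n : C(Torus, ℂ)) :=
  ContinuousMap.coeFn_toLp (p := 2) (𝕜 := ℂ) volume (fourier n)

theorem mulSin_expL2 (n : ℤ) :
    mulSin (expL2 n) = (-Complex.I / 2) • (expL2 (n + 1) - expL2 (n - 1)) := by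
  apply Lp.ext
  filter_upwards [coeFn_mulSin (expL2 n), coeFn_expL2 n, coeFn_expL2 (n + 1),
    coeFn_expL2 (n - 1), Lp.coeFn_smul (-Complex.I / 2) (expL2 (n + 1) - expL2 (n - 1)),
    Lp.coeFn_sub (expL2 (n + 1)) (expL2 (n - 1))] with x h1 h2 h3 h4 h5 h6
  rw [h1, h5, Pi.smul_apply, h6, Pi.sub_apply, h2, h3, h4, smul_eq_mul, sinT_mul_fourier]

theorem mulCos_expL2 (n : ℤ) :
    mulCos (expL2 n) = (1 / 2 : ℂ) • (expL2 (n + 1) + expL2 (n - 1)) := by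
  apply Lp.ext
  filter_upwards [coeFn_mulCos (expL2 n), coeFn_expL2 n, coeFn_expL2 (n + 1),
    coeFn_expL2 (n - 1), Lp.coeFn_smul (1 / 2 : ℂ) (expL2 (n + 1) + expL2 (n - 1)),
    Lp.coeFn_add (expL2 (n + 1)) (expL2 (n - 1))] with x h1 h2 h3 h4 h5 h6
  rw [h1, h5, Pi.smul_apply, h6, Pi.add_apply, h2, h3, h4, smul_eq_mul, cosT_mul_fourier]

theorem inner_expL2_mulSin (n : ℤ) (f : L2T) :
    inner ℂ (expL2 n) (mulSin f) = (Complex.I / 2) *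
      (inner ℂ (expL2 (n + 1)) f - inner ℂ (expL2 (n - 1)) f) := by
  rw [← mulSin_symm, mulSin_expL2, inner_smul_left, inner_sub_left]
  simp [map_ofNat]

theorem inner_expL2_mulCos (n : ℤ) (f : L2T) :
    inner ℂ (expL2 n) (mulCos f) = (1 / 2) *
      (inner ℂ (expL2 (n + 1)) f + inner ℂ (expL2 (n - 1)) f) := by
  rw [← mulCos_symm, mulCos_expL2, inner_smul_left, inner_add_left]
  simp [map_ofNat]

theorem norm_mulSin_sq_add_norm_mulCos_sq (f : L2T) :
    ‖mulSin f‖ ^ 2 + ‖mulCos f‖ ^ 2 = ‖f‖ ^ 2 := by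
  have h : mulSin (mulSin f) + mulCos (mulCos f) = f := by
    refine ext_inner_expL2 fun n => ?_
    rw [inner_add_right]
    simp only [inner_expL2_mulSin, inner_expL2_mulCos, add_sub_cancel_right, sub_add_cancel]
    linear_combination (1 / 4 : ℂ) * (inner ℂ (expL2 (n + 1 + 1)) f - 2 * inner ℂ (expL2 n) f +
      inner ℂ (expL2 (n - 1 - 1)) f) * Complex.I_sq
  rw [← re_inner_self (mulSin f), ← re_inner_self (mulCos f), ← mulSin_symm (mulSin f) f,
    ← mulCos_symm (mulCos f) f, ← Complex.add_re, ← inner_add_left, h, re_inner_self]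

theorem norm_mulSin_le (f : L2T) : ‖mulSin f‖ ≤ ‖f‖ := by
  refine le_of_sq_le_sq ?_ (norm_nonneg _)
  nlinarith [norm_mulSin_sq_add_norm_mulCos_sq f, sq_nonneg ‖mulCos f‖]

theorem norm_mulCos_le (f : L2T) : ‖mulCos f‖ ≤ ‖f‖ := by
  refine le_of_sq_le_sq ?_ (norm_nonneg _)
  nlinarith [norm_mulSin_sq_add_norm_mulCos_sq f, sq_nonneg ‖mulSin f‖]

theorem mulSin_mulCos (f : L2T) : mulSin (mulCos f) = mulCos (mulSin f) := by
  refine ext_inner_expL2 fun n => ?_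
  simp only [inner_expL2_mulSin, inner_expL2_mulCos, add_sub_cancel_right, sub_add_cancel]
  ring

/-! ### Calculus on the graph of the weak derivative -/

/-- The graph of the weak derivative. -/
def weakDerivGraph : Submodule ℂ (L2T × L2T) where
  carrier := {p | IsWeakDeriv p.1 p.2}
  add_mem' := by
    intro p q hp hq
    simp only [Set.mem_ofPred_eq, isWeakDeriv_iff] at *
    intro n
    rw [Prod.snd_add, Prod.fst_add, inner_add_right, inner_add_right, hp, hq]
    ring
  zero_mem' := by
    simp only [Set.mem_ofPred_eq, isWeakDeriv_iff]
    simp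
  smul_mem' := by
    intro c p hp
    simp only [Set.mem_ofPred_eq, isWeakDeriv_iff] at *
    intro n
    rw [Prod.smul_snd, Prod.smul_fst, inner_smul_right, inner_smul_right, hp]
    ring

theorem mem_weakDerivGraph {f g : L2T} :
    (f, g) ∈ weakDerivGraph ↔
      ∀ n : ℤ, inner ℂ (expL2 n) g = Complex.I * n * inner ℂ (expL2 n) f :=
  isWeakDeriv_iff f g

theorem inner_weakDeriv {x x' y y' : L2T} (hx : (x, x') ∈ weakDerivGraph)
    (hy : (y, y') ∈ weakDerivGraph) : inner ℂ x' y = -inner ℂ x y' := by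
  rw [mem_weakDerivGraph] at hx hy
  rw [← inner_neg_right]
  refine inner_eq_of_coef fun n => ?_
  rw [← inner_conj_symm x', hx, inner_neg_right, hy, map_mul, inner_conj_symm]
  simp
  ring

theorem weakDeriv_mulSin {x x' : L2T} (hx : (x, x') ∈ weakDerivGraph) :
    (mulSin x, mulSin x' + mulCos x) ∈ weakDerivGraph := by
  rw [mem_weakDerivGraph] at *
  intro n
  rw [inner_add_right]
  simp only [inner_expL2_mulSin, inner_expL2_mulCos, hx]
  push_cast
  linear_combination (1 / 2 : ℂ) * (inner ℂ (expL2 (n + 1)) x + inner ℂ (expL2 (n - 1)) x) *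
    Complex.I_sq

theorem weakDeriv_mulCos {x x' : L2T} (hx : (x, x') ∈ weakDerivGraph) :
    (mulCos x, mulCos x' - mulSin x) ∈ weakDerivGraph := by
  rw [mem_weakDerivGraph] at *
  intro n
  rw [inner_sub_right]
  simp only [inner_expL2_mulSin, inner_expL2_mulCos, hx]
  push_cast
  ring

theorem norm_le_norm_weakDeriv {x x' : L2T} (hx : (x, x') ∈ weakDerivGraph)
    (h0 : inner ℂ (expL2 0) x = 0) : ‖x‖ ≤ ‖x'‖ := by
  rw [mem_weakDerivGraph] at hx
  refine norm_le_of_coef fun n => ?_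
  rcases eq_or_ne n 0 with rfl | hn
  · simp [h0]
  · rw [hx, norm_mul, norm_mul, Complex.norm_I, one_mul, Complex.norm_intCast]
    refine le_mul_of_one_le_left (norm_nonneg _) ?_
    exact_mod_cast Int.one_le_abs hn

theorem exists_weakDeriv_of_mem_H2 (u : H2) :
    ∃ u₁ : L2T, ((u : L2T), u₁) ∈ weakDerivGraph ∧ (u₁, secondDeriv u) ∈ weakDerivGraph :=
  (secondDeriv_eq_iff u _).mp rfl

theorem weakDeriv_multiplier {m : ℤ → ℂ} {K : ℝ} (hm : ∀ n, ‖m n‖ ≤ K) {x x' : L2T}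
    (hx : (x, x') ∈ weakDerivGraph) :
    (multiplier m K hm x, multiplier m K hm x') ∈ weakDerivGraph := by
  rw [mem_weakDerivGraph] at *
  intro n
  rw [inner_multiplier, inner_multiplier, hx]
  ring

/-! ### The symmetrised operators -/

/-- The symbol of `(1 - (1 - ∂²)⁻¹)^{1/2}`. -/
def kap (n : ℤ) : ℝ := √((n : ℝ) ^ 2 / (1 + (n : ℝ) ^ 2))

theorem kap_sq (n : ℤ) : kap n ^ 2 = (n : ℝ) ^ 2 / (1 + (n : ℝ) ^ 2) :=
  Real.sq_sqrt (by positivity)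

theorem kap_zero : kap 0 = 0 := by simp [kap]

theorem norm_kap_le (n : ℤ) : ‖(kap n : ℂ)‖ ≤ 1 := by
  rw [Complex.norm_real, Real.norm_of_nonneg (show 0 ≤ kap n from Real.sqrt_nonneg _)]
  refine le_of_sq_le_sq ?_ zero_le_one
  rw [kap_sq, div_le_iff₀ (by positivity)]
  linarith

/-- The operator `(1 - (1 - ∂²)⁻¹)^{1/2}`. -/
def sqrtK : L2T →ₗ[ℂ] L2T := multiplier (fun n => (kap n : ℂ)) 1 norm_kap_le

theorem inner_sqrtK (f : L2T) (n : ℤ) :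
    inner ℂ (expL2 n) (sqrtK f) = kap n * inner ℂ (expL2 n) f :=
  inner_multiplier norm_kap_le f n

theorem sqrtK_symm : sqrtK.IsSymmetric := multiplier_symm norm_kap_le

/-- The operator `2 sin y`, symmetrised. -/
def symSin : L2T →ₗ[ℂ] L2T := (2 : ℂ) • (sqrtK ∘ₗ mulSin ∘ₗ sqrtK)

/-- The operator `2 cos y`, symmetrised. -/
def symCos : L2T →ₗ[ℂ] L2T := (2 : ℂ) • (sqrtK ∘ₗ mulCos ∘ₗ sqrtK)

theorem inner_symSin (f : L2T) (n : ℤ) :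
    inner ℂ (expL2 n) (symSin f) = Complex.I * kap n *
      (kap (n + 1) * inner ℂ (expL2 (n + 1)) f - kap (n - 1) * inner ℂ (expL2 (n - 1)) f) := by
  have h : symSin f = (2 : ℂ) • sqrtK (mulSin (sqrtK f)) := rfl
  rw [h, inner_smul_right, inner_sqrtK, inner_expL2_mulSin, inner_sqrtK, inner_sqrtK]
  ring

theorem inner_symCos (f : L2T) (n : ℤ) :
    inner ℂ (expL2 n) (symCos f) = kap n *
      (kap (n + 1) * inner ℂ (expL2 (n + 1)) f + kap (n - 1) * inner ℂ (expL2 (n - 1)) f) := by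
  have h : symCos f = (2 : ℂ) • sqrtK (mulCos (sqrtK f)) := rfl
  rw [h, inner_smul_right, inner_sqrtK, inner_expL2_mulCos, inner_sqrtK, inner_sqrtK]
  ring

/-- The symbol of `∂ [2 cos, 2 sin]`. -/
def commSymbol (n : ℤ) : ℝ := 8 * (n : ℝ) ^ 4 / ((1 + (n : ℝ) ^ 2) * ((n : ℝ) ^ 4 + 4))

theorem commSymbol_nonneg (n : ℤ) : 0 ≤ commSymbol n := by
  unfold commSymbol
  positivity

theorem norm_commSymbol_le (n : ℤ) : ‖(commSymbol n : ℂ)‖ ≤ 8 := by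
  rw [Complex.norm_real, Real.norm_of_nonneg (commSymbol_nonneg n), commSymbol,
    div_le_iff₀ (by positivity)]
  have h1 : (n : ℝ) ^ 4 ≤ (n : ℝ) ^ 4 + 4 := by linarith
  have h2 : 0 ≤ (n : ℝ) ^ 2 * ((n : ℝ) ^ 4 + 4) := by positivity
  linarith

/-- The operator `∂ [2 cos, 2 sin]`. -/
def commOp : L2T →ₗ[ℂ] L2T := multiplier (fun n => (commSymbol n : ℂ)) 8 norm_commSymbol_le

theorem inner_commOp (f : L2T) (n : ℤ) :
    inner ℂ (expL2 n) (commOp f) = commSymbol n * inner ℂ (expL2 n) f :=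
  inner_multiplier norm_commSymbol_le f n

theorem add_four_factor (n : ℝ) : (1 + (n + 1) ^ 2) * (1 + (n - 1) ^ 2) = n ^ 4 + 4 := by ring

/-- As `kap² = 1 - 1/(1 + n²)`, the difference of the two shifted squares is `4n/(n⁴ + 4)`, of the
same sign as `n`; hence the factor `n` coming from `∂` makes the symbol nonnegative. -/
theorem commSymbol_eq (n : ℤ) :
    2 * n * (kap n ^ 2 * (kap (n + 1) ^ 2 - kap (n - 1) ^ 2)) = commSymbol n := by
  rw [kap_sq, kap_sq, kap_sq, commSymbol, ← add_four_factor]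
  push_cast
  field_simp
  ring

/-- The symbol of the symmetrised `4 sin² + 4 cos²`. -/
def sumSymbol (n : ℤ) : ℝ := 2 * (kap n ^ 2 * (kap (n + 1) ^ 2 + kap (n - 1) ^ 2))

theorem sumSymbol_eq (n : ℤ) : sumSymbol n =
    4 * (n : ℝ) ^ 2 * ((n : ℝ) ^ 4 - (n : ℝ) ^ 2 + 2) /
      ((1 + (n : ℝ) ^ 2) * ((n : ℝ) ^ 4 + 4)) := by
  rw [sumSymbol, kap_sq, kap_sq, kap_sq, ← add_four_factor]
  push_cast
  field_simp
  ring

theorem sumSymbol_le (n : ℤ) : sumSymbol n ≤ 4 := by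
  rw [sumSymbol_eq, div_le_iff₀ (by positivity)]
  nlinarith [sq_nonneg (n : ℝ), sq_nonneg ((n : ℝ) ^ 2)]

/-- In `x = n²` the claim becomes `24x² - 8x - 16 ≥ 0`, with equality at `n = ±1`; so the factor `4`
in front of the commutator cannot be lowered. At `n = 0` both symbols vanish. -/
theorem four_le_sumSymbol {n : ℤ} (hn : n ≠ 0) : 4 ≤ sumSymbol n + 4 * commSymbol n := by
  have h1 : (1 : ℝ) ≤ (n : ℝ) ^ 2 := by
    have : 1 ≤ n ^ 2 := by
      have := Int.one_le_abs hn
      rw [← sq_abs]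
      nlinarith
    exact_mod_cast this
  rw [sumSymbol_eq, commSymbol, mul_div_assoc', ← add_div, le_div_iff₀ (by positivity)]
  have h2 : (n : ℝ) ^ 4 = (n : ℝ) ^ 2 * (n : ℝ) ^ 2 := by ring
  nlinarith

theorem inner_comm_symSin_symCos (f : L2T) (n : ℤ) :
    inner ℂ (expL2 n) (symCos (symSin f) - symSin (symCos f)) =
      -Complex.I * (2 * (kap n ^ 2 * (kap (n + 1) ^ 2 - kap (n - 1) ^ 2)) : ℝ) *
        inner ℂ (expL2 n) f := by
  rw [inner_sub_right]
  simp only [inner_symSin, inner_symCos, add_sub_cancel_right, sub_add_cancel]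
  push_cast
  ring

theorem inner_symSin_sq_add_symCos_sq (f : L2T) (n : ℤ) :
    inner ℂ (expL2 n) (symSin (symSin f) + symCos (symCos f)) =
      sumSymbol n * inner ℂ (expL2 n) f := by
  rw [inner_add_right]
  simp only [inner_symSin, inner_symCos, add_sub_cancel_right, sub_add_cancel, sumSymbol]
  push_cast
  ring_nf
  rw [Complex.I_sq]
  ring

theorem symSin_symm : symSin.IsSymmetric := by
  intro f g
  have h : ∀ f, symSin f = (2 : ℂ) • sqrtK (mulSin (sqrtK f)) := fun _ => rfl
  rw [h, h, inner_smul_left, inner_smul_right, sqrtK_symm, mulSin_symm, sqrtK_symm]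
  simp [map_ofNat]

theorem symCos_symm : symCos.IsSymmetric := by
  intro f g
  have h : ∀ f, symCos f = (2 : ℂ) • sqrtK (mulCos (sqrtK f)) := fun _ => rfl
  rw [h, h, inner_smul_left, inner_smul_right, sqrtK_symm, mulCos_symm, sqrtK_symm]
  simp [map_ofNat]

theorem hasSum_inner_multiplier {m : ℤ → ℝ} {f g : L2T}
    (h : ∀ n, inner ℂ (expL2 n) g = m n * inner ℂ (expL2 n) f) :
    HasSum (fun n : ℤ => m n * ((2 * Real.pi)⁻¹ * ‖inner ℂ (expL2 n) f‖ ^ 2))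
      (inner ℂ g f).re := by
  have h1 := Complex.reCLM.hasSum (hasSum_inner_expL2 g f)
  convert h1 using 1
  · ext n
    rw [← inner_conj_symm g (expL2 n), h, map_mul (starRingEnd ℂ), Complex.conj_ofReal,
      mul_assoc (m n : ℂ), ← Complex.normSq_eq_conj_mul_self, ← Complex.ofReal_inv,
      ← Complex.ofReal_mul, ← Complex.ofReal_mul, Complex.reCLM_apply, Complex.ofReal_re,
      Complex.normSq_eq_norm_sq]
    ring
  · rfl

theorem hasSum_symSin_symCos (f : L2T) :
    HasSum (fun n : ℤ => sumSymbol n * ((2 * Real.pi)⁻¹ * ‖inner ℂ (expL2 n) f‖ ^ 2))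
      (‖symSin f‖ ^ 2 + ‖symCos f‖ ^ 2) := by
  have h := hasSum_inner_multiplier (inner_symSin_sq_add_symCos_sq f)
  rwa [inner_add_left, symSin_symm, symCos_symm, Complex.add_re, re_inner_self,
    re_inner_self] at h

theorem isSinCosPair_symSin_symCos : IsSinCosPair weakDerivGraph symSin symCos commOp where
  inner_deriv := inner_weakDeriv
  deriv_sin {x x'} hx := by
    rw [mem_weakDerivGraph] at *
    intro n
    rw [inner_add_right]
    simp only [inner_symSin, inner_symCos, hx]
    push_cast
    linear_combination kap n * (kap (n + 1) * inner ℂ (expL2 (n + 1)) x +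
      kap (n - 1) * inner ℂ (expL2 (n - 1)) x) * Complex.I_sq
  deriv_cos {x x'} hx := by
    rw [mem_weakDerivGraph] at *
    intro n
    rw [inner_sub_right]
    simp only [inner_symSin, inner_symCos, hx]
    push_cast
    ring
  sin_symm := symSin_symm
  cos_symm := symCos_symm
  deriv_comm x := by
    rw [mem_weakDerivGraph]
    intro n
    rw [inner_comm_symSin_symCos, inner_commOp, ← commSymbol_eq]
    push_cast
    linear_combination (2 * n * (kap n ^ 2 * (kap (n + 1) ^ 2 - kap (n - 1) ^ 2))) *
      inner ℂ (expL2 n) x * Complex.I_sq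
  comm_nonneg x :=
    (hasSum_inner_multiplier (inner_commOp x)).nonneg fun n =>
      mul_nonneg (commSymbol_nonneg n) (by positivity)
  sq_add_sq_le x := by
    refine hasSum_le (fun n => ?_) (hasSum_symSin_symCos x) ((hasSum_norm_sq x).mul_left 4)
    exact mul_le_mul_of_nonneg_right (sumSymbol_le n) (by positivity)

theorem four_mul_norm_sq_le (x : L2T) (h0 : inner ℂ (expL2 0) x = 0) :
    4 * ‖x‖ ^ 2 ≤ ‖symSin x‖ ^ 2 + ‖symCos x‖ ^ 2 + 4 * (inner ℂ (commOp x) x).re := by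
  refine hasSum_le (fun n => ?_) ((hasSum_norm_sq x).mul_left 4)
    ((hasSum_symSin_symCos x).add ((hasSum_inner_multiplier (inner_commOp x)).mul_left 4))
  rcases eq_or_ne n 0 with rfl | hn
  · simp [h0]
  · have := mul_le_mul_of_nonneg_right (four_le_sumSymbol hn)
      (show 0 ≤ (2 * Real.pi)⁻¹ * ‖inner ℂ (expL2 n) x‖ ^ 2 by positivity)
    linarith

/-! ### The pseudospectral bound -/

theorem expL2_zero : expL2 0 = one := by
  apply Lp.ext
  filter_upwards [coeFn_expL2 0, Lp.coeFn_const 2 (volume : Measure Torus) (1 : ℂ)] with x h1 h2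
  rw [h1, one, h2]
  simp

theorem mem_meanZero_iff (f : L2T) : f ∈ meanZero ↔ inner ℂ (expL2 0) f = 0 := by
  rw [meanZero_eq, Submodule.mem_orthogonal_singleton_iff_inner_right, expL2_zero]

theorem expL2_mem_meanZero {n : ℤ} (hn : n ≠ 0) : expL2 n ∈ meanZero := by
  rw [mem_meanZero_iff, inner_expL2_expL2, if_neg hn.symm]

theorem sub_helmholtzInv_one (f : L2T) : f - helmholtzInv 1 f = sqrtK (sqrtK f) := by
  obtain ⟨u, hu⟩ := (helmholtz_bijective one_pos).2 f
  have h1 : helmholtzInv 1 f = u := (helmholtzInv_eq_iff one_pos f u).mpr hu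
  refine ext_inner_expL2 fun n => ?_
  rw [h1, inner_sub_right, inner_sqrtK, inner_sqrtK, ← mul_assoc, ← Complex.ofReal_mul, ← sq,
    kap_sq, ← hu, inner_expL2_helmholtz, ← mul_assoc, ← Complex.ofReal_mul,
    div_mul_cancel₀ _ (by positivity)]
  push_cast
  ring

theorem starNorm_eq (f : meanZero) : starNorm f = ‖sqrtK (f : L2T)‖ := by
  rw [starNorm, sub_helmholtzInv_one, ← sqrtK_symm, re_inner_self, Real.sqrt_sq (norm_nonneg _)]

/-- `Q1` changes only the zero mode, which `sqrtK` annihilates; this is why the projection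
disappears from the star norm. -/
theorem sqrtK_Q1 (f : L2T) : sqrtK (Q1 f : L2T) = sqrtK f := by
  refine ext_inner_expL2 fun n => ?_
  rw [inner_sqrtK, inner_sqrtK]
  rcases eq_or_ne n 0 with rfl | hn
  · simp [kap_zero]
  · congr 1
    exact Submodule.inner_orthogonalProjectionOnto_eq_of_mem_left ⟨_, expL2_mem_meanZero hn⟩ f

theorem expL2_mem_H2 (n : ℤ) : expL2 n ∈ H2 := by
  rw [mem_H2_iff]
  refine ⟨(Complex.I * n) • expL2 n, (Complex.I * n) • (Complex.I * n) • expL2 n, ?_, ?_⟩ <;>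
  · rw [isWeakDeriv_iff]
    intro m
    simp only [inner_smul_right, inner_expL2_expL2]
    split_ifs with h
    · rw [h]
    · simp

/-- Conjugation by `sqrtK` reduces this to `IsSinCosPair.norm_ge` for `g = sqrtK u`, where `β =
|k₁γ|/(2ν²)` and the spectral parameter is rescaled accordingly. -/
theorem starNorm_opQ1L'_sub_ge {ν γ kf : ℝ} {k₁ k₃ : ℤ} (hν : 0 < ν)
    (hk : (k₁ : ℝ) ^ 2 + (k₃ : ℝ) ^ 2 = kf ^ 2) (hkf : kf ^ 2 = 1) (f : (opQ1L' ν γ kf k₁ k₃).domain) (μ : ℝ) :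
    (1 / 32) ^ 4 / 2 * √|k₁ * γ| * starNorm f ≤
      starNorm (opQ1L' ν γ kf k₁ k₃ f - (Complex.I * (μ : ℂ)) • (f : meanZero)) := by
  obtain ⟨u, hu⟩ : ∃ u : H2, (u : L2T) = ((f : meanZero) : L2T) := ⟨⟨_, f.2⟩, rfl⟩
  obtain ⟨α, hα⟩ : ∃ α : ℝ, α = k₁ * γ := ⟨_, rfl⟩
  have h1 : opQ1L' ν γ kf k₁ k₃ f = Q1 (-(ν : ℂ) • secondDeriv u + (Complex.I * (α / ν : ℝ)) •
      mulSin (sqrtK (sqrtK u))) := by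
    have e : opQ1L' ν γ kf k₁ k₃ f = Q1 (-((ν * kf ^ 2 : ℝ) : ℂ) • secondDeriv u +
      (Complex.I * (k₁ / kf ^ 2 * (γ / ν) : ℝ)) • mulSin ((u : L2T) -
        helmholtzInv (((k₁ : ℝ) ^ 2 + (k₃ : ℝ) ^ 2) / kf ^ 2) u)) := by
      have hu' : u = ⟨_, f.2⟩ := Subtype.ext hu
      rw [hu']
      rfl
    rw [e, hk, hkf, div_one, div_one, mul_one, sub_helmholtzInv_one, hα, mul_div_assoc]
  have h0 : inner ℂ (expL2 0) (u : L2T) = 0 := by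
    rw [hu, ← mem_meanZero_iff]
    exact (f : meanZero).2
  obtain ⟨u₁, hu1, hu2⟩ := exists_weakDeriv_of_mem_H2 u
  have hg1 : (sqrtK u, sqrtK u₁) ∈ weakDerivGraph := weakDeriv_multiplier _ hu1
  have hg2 : (sqrtK u₁, sqrtK (secondDeriv u)) ∈ weakDerivGraph := weakDeriv_multiplier _ hu2
  have hg0 : inner ℂ (expL2 0) (sqrtK (u : L2T)) = 0 := by rw [inner_sqrtK, h0, mul_zero]
  rw [starNorm_eq, starNorm_eq, ← hα, ← hu, Submodule.coe_sub, Submodule.coe_smul, map_sub, h1,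
    sqrtK_Q1, ← hu]
  rcases eq_or_ne α 0 with h | hα0
  · simp [h]
  have hs : symSin (sqrtK u) = (2 : ℂ) • sqrtK (mulSin (sqrtK (sqrtK u))) := rfl
  have hβ : 0 < |α| / (2 * ν ^ 2) := by positivity
  -- The abstract bound needs a positive coefficient, so the sign of `α` is moved into the pair;
  -- `(-S, -C)` satisfies the same relations with the same `P`.
  obtain ⟨C, P, S, σ, hpair, hS, hσ, hlow⟩ : ∃ (C P S : L2T →ₗ[ℂ] L2T) (σ : ℝ),
      IsSinCosPair weakDerivGraph S C P ∧ S (sqrtK u) = (σ : ℂ) • symSin (sqrtK u) ∧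
      |α| * σ = α ∧ 4 * ‖sqrtK (u : L2T)‖ ^ 2 ≤ ‖S (sqrtK u)‖ ^ 2 + ‖C (sqrtK u)‖ ^ 2 +
        4 * (inner ℂ (P (sqrtK u)) (sqrtK (u : L2T))).re := by
    rcases le_total 0 α with h | h
    · exact ⟨symCos, commOp, symSin, 1, isSinCosPair_symSin_symCos, by simp,
        by rw [abs_of_nonneg h, mul_one], four_mul_norm_sq_le _ hg0⟩
    · exact ⟨-symCos, commOp, -symSin, -1, isSinCosPair_symSin_symCos.neg, by simp,
        by rw [abs_of_nonpos h]; ring, by simpa using four_mul_norm_sq_le _ hg0⟩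
  have key := hpair.norm_ge hg1 hg2 hβ (μ := 2 * ν * μ / |α|) rfl hlow
    (norm_le_norm_weakDeriv hg1 hg0)
  have hν' : (ν : ℂ) ≠ 0 := Complex.ofReal_ne_zero.mpr hν.ne'
  have hα' : ((|α| : ℝ) : ℂ) ≠ 0 := Complex.ofReal_ne_zero.mpr (abs_pos.mpr hα0).ne'
  have hσ' : ((|α| : ℝ) : ℂ) * σ = α := by rw [← Complex.ofReal_mul, hσ]
  have e : sqrtK (-(ν : ℂ) • secondDeriv u + (Complex.I * (α / ν : ℝ)) •
      mulSin (sqrtK (sqrtK u))) - sqrtK ((Complex.I * (μ : ℂ)) • (u : L2T)) =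
      (ν : ℂ) • (-sqrtK (secondDeriv u) + (Complex.I * (|α| / (2 * ν ^ 2) : ℝ)) •
        (S (sqrtK u) - ((2 * ν * μ / |α| : ℝ) : ℂ) • sqrtK u)) := by
    rw [hS, hs, map_add, map_smul, map_smul, map_smul]
    push_cast
    rw [← hσ']
    match_scalars <;> field_simp
  rw [e, norm_smul, Complex.norm_real, Real.norm_of_nonneg hν.le]
  refine le_trans ?_ (mul_le_mul_of_nonneg_left key hν.le)
  have e2 : √(|α| / 4) ≤ ν * √(|α| / (2 * ν ^ 2)) := by
    refine Real.sqrt_le_iff.mpr ⟨by positivity, ?_⟩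
    rw [mul_pow, Real.sq_sqrt hβ.le]
    have : ν ^ 2 * (|α| / (2 * ν ^ 2)) = |α| / 2 := by field_simp
    rw [this]
    linarith [abs_nonneg α]
  have e3 : √(|α| / 4) = √|α| / 2 := by
    rw [Real.sqrt_div (abs_nonneg α)]
    congr 1
    rw [show (4 : ℝ) = 2 ^ 2 by norm_num, Real.sqrt_sq (by norm_num)]
  rw [e3] at e2
  calc (1 / 32) ^ 4 / 2 * √|α| * ‖sqrtK (u : L2T)‖
      = (1 / 32) ^ 4 * (√|α| / 2) * ‖sqrtK (u : L2T)‖ := by ring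
    _ ≤ (1 / 32) ^ 4 * (ν * √(|α| / (2 * ν ^ 2))) * ‖sqrtK (u : L2T)‖ := by gcongr
    _ = _ := by ring

/-- The real infimum of the empty set is `0`, so a lower bound for the pseudospectral quantity
requires an admissible unit vector. -/
theorem exists_starNorm_eq_one : ∃ f : meanZero, (f : L2T) ∈ H2 ∧ starNorm f = 1 := by
  obtain ⟨f, hf⟩ : ∃ f : meanZero, (f : L2T) = expL2 1 :=
    ⟨⟨_, expL2_mem_meanZero one_ne_zero⟩, rfl⟩
  have h1 : sqrtK (expL2 1) ≠ 0 := by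
    intro h
    have h2 := inner_sqrtK (expL2 1) 1
    rw [h, inner_zero_right, inner_expL2_expL2, if_pos rfl] at h2
    have h3 : kap 1 ≠ 0 := fun h => by
      have := kap_sq 1
      rw [h] at this
      norm_num at this
    refine mul_ne_zero (Complex.ofReal_ne_zero.mpr h3) ?_ h2.symm
    exact Complex.ofReal_ne_zero.mpr Real.two_pi_pos.ne'
  refine ⟨((‖sqrtK (expL2 1)‖⁻¹ : ℝ) : ℂ) • f, ?_, ?_⟩
  · rw [Submodule.coe_smul, hf]
    exact H2.smul_mem _ (expL2_mem_H2 1)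
  · rw [starNorm_eq, Submodule.coe_smul, map_smul, norm_smul, hf, Complex.norm_real,
      Real.norm_of_nonneg (by positivity), inv_mul_cancel₀ (norm_ne_zero_iff.mpr h1)]

theorem pseudospectralBound_ge {ν γ kf : ℝ} {k₁ k₃ : ℤ} (hν : 0 < ν)
    (hk : (k₁ : ℝ) ^ 2 + (k₃ : ℝ) ^ 2 = kf ^ 2) (hkf : kf ^ 2 = 1) :
    (1 / 32) ^ 4 / 2 * |k₁ * γ| ^ (1 / 2 : ℝ) ≤
      pseudospectralBound starNorm (opQ1L' ν γ kf k₁ k₃) := by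
  rw [← Real.sqrt_eq_rpow]
  refine le_csInf ?_ ?_
  · obtain ⟨f, hf, hf1⟩ := exists_starNorm_eq_one
    exact ⟨_, ⟨f, hf⟩, 0, hf1, rfl⟩
  · rintro r ⟨f, μ, hf, rfl⟩
    have := starNorm_opQ1L'_sub_ge hν hk hkf f μ
    rwa [hf, mul_one] at this

/-! ### The equation `u'' - u - i b sin y u = f` -/

section Equation

variable {u u₁ u₂ f : L2T} {b : ℝ}

theorem sq_norm_add_sq_norm_deriv (h1 : (u, u₁) ∈ weakDerivGraph) (h2 : (u₁, u₂) ∈ weakDerivGraph)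
    (hf : f = u₂ - u - (Complex.I * (b : ℂ)) • mulSin u) :
    ‖u‖ ^ 2 + ‖u₁‖ ^ 2 = -(inner ℂ u f).re := by
  have e1 : inner ℂ u u₂ = -inner ℂ u₁ u₁ := by rw [inner_weakDeriv h1 h2, neg_neg]
  have h3 := im_inner_symmetric mulSin_symm u
  rw [mulSin_symm u u] at h3
  rw [hf, inner_sub_right, inner_sub_right, inner_smul_right, e1, ← re_inner_self,
    ← re_inner_self]
  simp only [Complex.sub_re, Complex.neg_re, Complex.mul_re, Complex.mul_im, h3, Complex.I_re,
    Complex.I_im, Complex.ofReal_re, Complex.ofReal_im]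
  ring

theorem sq_norm_add_sq_norm_deriv_le (h1 : (u, u₁) ∈ weakDerivGraph)
    (h2 : (u₁, u₂) ∈ weakDerivGraph) (hf : f = u₂ - u - (Complex.I * (b : ℂ)) • mulSin u) :
    ‖u‖ ^ 2 + ‖u₁‖ ^ 2 ≤ ‖f‖ * ‖u‖ := by
  rw [sq_norm_add_sq_norm_deriv h1 h2 hf, mul_comm ‖f‖]
  exact (neg_le_abs _).trans (abs_re_inner_le u f)

/-- Imaginary part of the equation paired with `sin y u`; the commutator with `∂²` leaves only `⟨cos
y u, u'⟩`. -/
theorem abs_mul_sq_norm_mulSin_le (h1 : (u, u₁) ∈ weakDerivGraph)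
    (h2 : (u₁, u₂) ∈ weakDerivGraph) (hf : f = u₂ - u - (Complex.I * (b : ℂ)) • mulSin u) :
    |b| * ‖mulSin u‖ ^ 2 ≤ ‖f‖ * ‖mulSin u‖ + ‖u‖ * ‖u₁‖ := by
  have e1 : inner ℂ (mulSin u) u₂ = -inner ℂ (mulSin u₁ + mulCos u) u₁ := by
    rw [inner_weakDeriv (weakDeriv_mulSin h1) h2, neg_neg]
  have e2 : b * ‖mulSin u‖ ^ 2 = -(inner ℂ (mulSin u) f).im - (inner ℂ (mulCos u) u₁).im := by
    rw [hf, inner_sub_right, inner_sub_right, inner_smul_right, e1, inner_add_left,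
      ← re_inner_self]
    simp only [Complex.sub_im, Complex.neg_im, Complex.add_im, Complex.mul_re, Complex.mul_im,
      im_inner_symmetric mulSin_symm, Complex.I_re, Complex.I_im, Complex.ofReal_re,
      Complex.ofReal_im]
    ring
  have e3 := abs_im_inner_le (mulSin u) f
  have e4 := abs_im_inner_le (mulCos u) u₁
  have e6 := mul_le_mul_of_nonneg_right (norm_mulCos_le u) (norm_nonneg u₁)
  rw [← abs_of_nonneg (sq_nonneg ‖mulSin u‖), ← abs_mul, e2]
  have e7 := abs_sub (-(inner ℂ (mulSin u) f).im) (inner ℂ (mulCos u) u₁).im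
  rw [abs_neg] at e7
  linarith

/-- Uncertainty principle at the zeros of the sine: integrating by parts between `cos y u` and `sin
y u` controls `‖cos y u‖² - ‖sin y u‖²`, and `sin² + cos² = 1` completes it. -/
theorem sq_norm_le_mulSin (h1 : (u, u₁) ∈ weakDerivGraph) :
    ‖u‖ ^ 2 ≤ 2 * ‖mulSin u‖ ^ 2 + 2 * (‖mulSin u‖ * ‖u₁‖) := by
  have e1 := inner_weakDeriv (weakDeriv_mulCos h1) (weakDeriv_mulSin h1)
  have e0 : inner ℂ (mulCos u) (mulSin u₁) = inner ℂ (mulSin u) (mulCos u₁) := by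
    rw [← mulSin_symm (mulCos u), mulSin_mulCos, mulCos_symm (mulSin u)]
  rw [inner_sub_left, inner_add_right, e0] at e1
  have e2 := congrArg Complex.re e1
  simp only [Complex.sub_re, Complex.neg_re, Complex.add_re, re_inner_self] at e2
  rw [re_inner_comm (mulCos u₁)] at e2
  have e3 := (neg_le_abs _).trans (abs_re_inner_le (mulSin u) (mulCos u₁))
  have e4 := mul_le_mul_of_nonneg_left (norm_mulCos_le u₁) (norm_nonneg (mulSin u))
  linarith [norm_mulSin_sq_add_norm_mulCos_sq u]

end Equation

/-- Solving the system of energy inequalities. -/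
theorem energy_system {F U V S r : ℝ} (hF : 0 ≤ F) (hU : 0 ≤ U) (hS : 0 ≤ S)
    (hr : 0 < r) (hSU : S ≤ U) (h1 : U ^ 2 + V ^ 2 ≤ F * U)
    (h2 : r ^ 3 * S ^ 2 ≤ F * S + U * V) (h3 : U ^ 2 ≤ 2 * S ^ 2 + 2 * (S * V)) :
    r ^ 2 * U ≤ 6 * F ∧ r ^ 3 * S ≤ 4 * F := by
  -- `S ≤ U` turns `h3` into `U² ≤ 2S(U + V)`; squaring and using `(U + V)² ≤ 2FU` eliminates `V`.
  -- The bound on `S` then absorbs `UV` through the same inequality.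
  have hU3 : U ^ 3 ≤ 8 * S ^ 2 * F := by
    rcases hU.eq_or_lt with h | hU0
    · rw [← h, zero_pow (by norm_num)]
      positivity
    · have a1 : U ^ 2 ≤ 2 * S * (U + V) := by nlinarith
      have a2 : (U ^ 2) ^ 2 ≤ (2 * S * (U + V)) ^ 2 := pow_le_pow_left₀ (by positivity) a1 2
      have a3 : (U + V) ^ 2 ≤ 2 * (F * U) := by nlinarith [sq_nonneg (U - V)]
      have a4 : 4 * S ^ 2 * (U + V) ^ 2 ≤ 4 * S ^ 2 * (2 * (F * U)) := by gcongr
      refine le_of_mul_le_mul_right (a := U) ?_ hU0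
      linarith
  have hB : r ^ 3 * S ≤ 4 * F := by
    have a1 : r ^ 3 * (U * V) ≤ 3 * ((r ^ 3 * S) * F) := by
      refine le_of_sq_le_sq ?_ (by positivity)
      have a2 : V ^ 2 ≤ F * U := by linarith [sq_nonneg U]
      calc (r ^ 3 * (U * V)) ^ 2 = r ^ 6 * U ^ 2 * V ^ 2 := by ring
        _ ≤ r ^ 6 * U ^ 2 * (F * U) := by gcongr
        _ = r ^ 6 * F * U ^ 3 := by ring
        _ ≤ r ^ 6 * F * (8 * S ^ 2 * F) := by gcongr
        _ = 8 * (r ^ 3 * S * F) ^ 2 := by ring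
        _ ≤ (3 * ((r ^ 3 * S) * F)) ^ 2 := by nlinarith [sq_nonneg (r ^ 3 * S * F)]
    rcases hS.eq_or_lt with h | hS0
    · rw [← h]
      linarith
    · have hb : 0 < r ^ 3 * S := by positivity
      refine le_of_mul_le_mul_right (a := r ^ 3 * S) ?_ hb
      have := mul_le_mul_of_nonneg_left h2 (show 0 ≤ r ^ 3 by positivity)
      linarith
  refine ⟨?_, hB⟩
  refine le_of_pow_le_pow_left₀ (n := 3) (by norm_num) (by positivity) ?_
  calc (r ^ 2 * U) ^ 3 = r ^ 6 * U ^ 3 := by ring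
    _ ≤ r ^ 6 * (8 * S ^ 2 * F) := by gcongr
    _ = 8 * (r ^ 3 * S) ^ 2 * F := by ring
    _ ≤ 8 * (4 * F) ^ 2 * F := by gcongr
    _ ≤ (6 * F) ^ 3 := by nlinarith [pow_nonneg hF 3]

/-! ### The inverse -/

/-- The symbol of `(1 - ∂²)^{-1/2}`. -/
def invSqrtSymbol (n : ℤ) : ℝ := √((1 + (n : ℝ) ^ 2)⁻¹)

theorem invSqrtSymbol_sq (n : ℤ) : invSqrtSymbol n ^ 2 = (1 + (n : ℝ) ^ 2)⁻¹ :=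
  Real.sq_sqrt (by positivity)

theorem norm_invSqrtSymbol_le (n : ℤ) : ‖(invSqrtSymbol n : ℂ)‖ ≤ 1 := by
  rw [Complex.norm_real, Real.norm_of_nonneg (show 0 ≤ invSqrtSymbol n from Real.sqrt_nonneg _)]
  refine le_of_sq_le_sq ?_ zero_le_one
  rw [invSqrtSymbol_sq, one_pow]
  exact inv_le_one_of_one_le₀ (by nlinarith [sq_nonneg (n : ℝ)])

theorem norm_multiplier_le {m : ℤ → ℂ} (hm : ∀ n, ‖m n‖ ≤ 1) (f : L2T) :
    ‖multiplier m 1 hm f‖ ≤ 1 * ‖f‖ := by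
  rw [one_mul]
  refine norm_le_of_coef fun n => ?_
  rw [inner_multiplier, norm_mul]
  exact mul_le_of_le_one_left (norm_nonneg _) (hm n)

/-- The bounded operator `(1 - ∂²)^{-1/2}`. -/
def invSqrt : L2T →L[ℂ] L2T :=
  (multiplier (fun n => (invSqrtSymbol n : ℂ)) 1 norm_invSqrtSymbol_le).mkContinuous 1
    (norm_multiplier_le norm_invSqrtSymbol_le)

/-- Multiplication by `sin y` as a bounded operator. -/
def mulSinCLM : L2T →L[ℂ] L2T :=
  mulSin.mkContinuous 1 fun f => by rw [one_mul]; exact norm_mulSin_le f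

theorem invSqrt_symm : (invSqrt : L2T →ₗ[ℂ] L2T).IsSymmetric :=
  multiplier_symm norm_invSqrtSymbol_le

theorem invSqrt_invSqrt (f : L2T) : invSqrt (invSqrt f) = helmholtzInv 1 f := by
  obtain ⟨u, hu⟩ := (helmholtz_bijective one_pos).2 f
  rw [show helmholtzInv 1 f = u from (helmholtzInv_eq_iff one_pos f u).mpr hu]
  refine ext_inner_expL2 fun n => ?_
  have h : ∀ f, inner ℂ (expL2 n) (invSqrt f) = invSqrtSymbol n * inner ℂ (expL2 n) f := fun f =>
    inner_multiplier norm_invSqrtSymbol_le f n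
  rw [h, h, ← mul_assoc, ← Complex.ofReal_mul, ← sq, invSqrtSymbol_sq, ← hu,
    inner_expL2_helmholtz, ← mul_assoc, ← Complex.ofReal_mul, inv_mul_cancel₀ (by positivity),
    Complex.ofReal_one, one_mul]

/-- The operator is `-ib(i/b - Y)`, and `i/b` is not real, hence not in the spectrum of `Y`. -/
theorem isUnit_one_add_smul {Y : L2T →L[ℂ] L2T} (hY : IsSelfAdjoint Y) {b : ℝ} (hb : b ≠ 0) :
    IsUnit (1 + (Complex.I * (b : ℂ)) • Y) := by
  have hb' : (b : ℂ) ≠ 0 := Complex.ofReal_ne_zero.mpr hb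
  have h1 : Complex.I / b ∉ spectrum ℂ Y := fun h => by
    have := hY.im_eq_zero_of_mem_spectrum h
    rw [Complex.div_ofReal_im, Complex.I_im] at this
    exact one_div_ne_zero hb this
  rw [spectrum.notMem_iff] at h1
  have h2 : -(Complex.I * (b : ℂ)) ≠ 0 := neg_ne_zero.mpr (mul_ne_zero Complex.I_ne_zero hb')
  have h3 := h1.smul (Units.mk0 _ h2)
  convert h3 using 1
  rw [Units.smul_mk0, Algebra.algebraMap_eq_smul_one, smul_sub, smul_smul]
  have h4 : -(Complex.I * (b : ℂ)) * (Complex.I / b) = 1 := by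
    field_simp
    rw [Complex.I_sq, neg_neg]
  rw [h4, one_smul]
  module

/-- `opL1` as a linear map on `H²`. -/
def opL1Fun (ν β : ℝ) : H2 →ₗ[ℂ] L2T := (opL1 ν β).toFun

theorem opL1Fun_apply {ν β : ℝ} (hν : ν ≠ 0) (u : H2) :
    opL1Fun ν β u = (ν : ℂ) • (secondDeriv u - (u : L2T) -
      (Complex.I * (β / ν ^ 2 : ℝ)) • mulSin u) := by
  have h : opL1Fun ν β u = (ν : ℂ) • secondDeriv u - (ν : ℂ) • (u : L2T) -
    (Complex.I * (β / ν : ℝ)) • mulSin u := rfl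
  have hν' : (ν : ℂ) ≠ 0 := Complex.ofReal_ne_zero.mpr hν
  rw [h]
  push_cast
  match_scalars <;> field_simp

theorem opL1Fun_injective {ν β : ℝ} (hν : ν ≠ 0) {u v : H2}
    (h : opL1Fun ν β u = opL1Fun ν β v) : u = v := by
  have hν' : (ν : ℂ) ≠ 0 := Complex.ofReal_ne_zero.mpr hν
  have h1 : opL1Fun ν β (u - v) = 0 := by rw [map_sub, h, sub_self]
  rw [opL1Fun_apply hν, smul_eq_zero_iff_right hν'] at h1
  obtain ⟨w₁, hw1, hw2⟩ := exists_weakDeriv_of_mem_H2 (u - v)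
  have h2 := sq_norm_add_sq_norm_deriv_le hw1 hw2 h1.symm
  rw [norm_zero, zero_mul] at h2
  have h3 : ((u - v : H2) : L2T) = 0 := by
    rw [← norm_eq_zero]
    nlinarith [sq_nonneg ‖((u - v : H2) : L2T)‖, sq_nonneg ‖w₁‖]
  exact sub_eq_zero.mp (Subtype.ext h3)

/-- With `R = invSqrt` and `b = β/ν²`, formally `L₁ = -ν R⁻¹(1 + ib R sin R)R⁻¹`, so the inverse is
`-ν⁻¹ R Z R`, with `Z` inverting the middle factor. That it is also a left inverse follows from
injectivity, i.e. from the energy estimate. -/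
theorem exists_isBoundedInverse {ν β : ℝ} (hν : 0 < ν) (hβ : β ≠ 0) :
    ∃ T : L2T →L[ℂ] L2T, IsBoundedInverse (opL1 ν β) T := by
  have hb : β / ν ^ 2 ≠ 0 := div_ne_zero hβ (by positivity)
  have hY : IsSelfAdjoint (invSqrt * mulSinCLM * invSqrt) := by
    rw [ContinuousLinearMap.isSelfAdjoint_iff_isSymmetric]
    intro f g
    change inner ℂ (invSqrt (mulSin (invSqrt f))) g = inner ℂ f (invSqrt (mulSin (invSqrt g)))
    exact (invSqrt_symm _ _).trans ((mulSin_symm _ _).trans (invSqrt_symm _ _))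
  obtain ⟨Z, hZ⟩ := (isUnit_one_add_smul hY hb).exists_right_inv
  have hν' : (ν : ℂ) ≠ 0 := Complex.ofReal_ne_zero.mpr hν.ne'
  obtain ⟨T, hT⟩ : ∃ T : L2T →L[ℂ] L2T, T = (-(ν : ℂ)⁻¹) • (invSqrt * Z * invSqrt) := ⟨_, rfl⟩
  have hright : ∀ f : L2T, ∃ u : H2, (u : L2T) = T f ∧ opL1Fun ν β u = f := by
    intro f
    have h1 : Z (invSqrt f) + (Complex.I * (β / ν ^ 2 : ℝ)) •
        invSqrt (mulSin (invSqrt (Z (invSqrt f)))) = invSqrt f :=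
      congrArg (fun A : L2T →L[ℂ] L2T => A (invSqrt f)) hZ
    obtain ⟨v, hv⟩ : ∃ v : L2T, v = invSqrt (Z (invSqrt f)) := ⟨_, rfl⟩
    rw [← hv] at h1
    have h2 : v = helmholtzInv 1 (f - (Complex.I * (β / ν ^ 2 : ℝ)) • mulSin v) := by
      have h3 := congrArg invSqrt h1
      rw [map_add, map_smul, ← hv, invSqrt_invSqrt, invSqrt_invSqrt] at h3
      rw [map_sub, map_smul, ← h3, add_sub_cancel_right]
    obtain ⟨w, hw⟩ := (helmholtz_bijective one_pos).2
      (f - (Complex.I * (β / ν ^ 2 : ℝ)) • mulSin v)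
    have h3 : helmholtzInv 1 (f - (Complex.I * (β / ν ^ 2 : ℝ)) • mulSin v) = w :=
      (helmholtzInv_eq_iff one_pos _ w).mpr hw
    rw [h3] at h2
    have hw' : ((1 : ℝ) : ℂ) • (w : L2T) - secondDeriv w =
      f - (Complex.I * (β / ν ^ 2 : ℝ)) • mulSin v := hw
    refine ⟨(-(ν : ℂ)⁻¹) • w, ?_, ?_⟩
    · rw [hT, Submodule.coe_smul, ← h2, hv]
      rfl
    · rw [map_smul, opL1Fun_apply hν.ne', smul_smul, neg_mul, inv_mul_cancel₀ hν', ← h2]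
      rw [← h2, Complex.ofReal_one, one_smul] at hw'
      have h4 : f = v - secondDeriv w + (Complex.I * (β / ν ^ 2 : ℝ)) • mulSin v := by
        rw [hw', sub_add_cancel]
      rw [h4]
      module
  refine ⟨T, fun u => ?_, fun f => ?_⟩
  · obtain ⟨v, hv, hv2⟩ := hright (opL1 ν β u)
    rw [← hv, opL1Fun_injective hν.ne' (u := v) (v := u) hv2]
  · obtain ⟨⟨u, hu⟩, rfl, hu2⟩ := hright f
    exact ⟨hu, hu2⟩

/-! ### The `L¹` bound -/

theorem norm_sq_eq_integral (f : L2T) : ‖f‖ ^ 2 = ∫ y : Torus, ‖f y‖ ^ 2 := by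
  rw [← re_inner_self, L2.inner_def]
  have h : ∀ y : Torus, inner ℂ (f y) (f y) = ((‖f y‖ ^ 2 : ℝ) : ℂ) := fun y => by
    rw [inner_self_eq_norm_sq_to_K]
    norm_cast
  simp only [h]
  rw [integral_complex_ofReal, Complex.ofReal_re]

theorem norm_mulSin_sq_eq_integral (f : L2T) :
    ‖mulSin f‖ ^ 2 = ∫ y : Torus, sinT y ^ 2 * ‖f y‖ ^ 2 := by
  rw [norm_sq_eq_integral]
  refine integral_congr_ae ?_
  filter_upwards [coeFn_mulSin f] with y hy
  rw [hy, norm_mul, mul_pow, Complex.norm_real, Real.norm_eq_abs, sq_abs]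

theorem hasDerivAt_arctan_sin {δ : ℝ} (hδ : 0 < δ) (y : ℝ) :
    HasDerivAt (fun y => δ⁻¹ * Real.arctan (Real.sin y / δ))
      (Real.cos y / (δ ^ 2 + Real.sin y ^ 2)) y := by
  have h := (((Real.hasDerivAt_sin y).div_const δ).arctan).const_mul δ⁻¹
  have h1 : 1 + (Real.sin y / δ) ^ 2 = (δ ^ 2 + Real.sin y ^ 2) / δ ^ 2 := by field_simp
  have h2 : 0 < δ ^ 2 + Real.sin y ^ 2 := by positivity
  rw [h1] at h
  exact h.congr_deriv (by field_simp)

/-- Where `s cos y ≥ 0`, one has `cos² y ≤ s cos y`, so `1 ≤ δ² + sin² y + s cos y`. This dominates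
the integrand by `1` plus an exact derivative, that of an arctangent. The sign `s` serves both half
periods. -/
theorem integral_inv_sin_sq_le {δ : ℝ} (hδ : 0 < δ) (hδ1 : δ ≤ 1) {a b s : ℝ} (hab : a ≤ b)
    (hs : s ^ 2 = 1) (hcos : ∀ y ∈ Set.Icc a b, 0 ≤ s * Real.cos y) (hlen : b - a = Real.pi) :
    ∫ y in a..b, (δ ^ 2 + Real.sin y ^ 2)⁻¹ ≤ 2 * Real.pi / δ := by
  have hpos : ∀ y, 0 < δ ^ 2 + Real.sin y ^ 2 := fun y => by positivity
  have hc1 : Continuous fun y => (δ ^ 2 + Real.sin y ^ 2)⁻¹ :=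
    Continuous.inv₀ (by fun_prop) fun y => (hpos y).ne'
  have hc2 : Continuous fun y => 1 + s * (Real.cos y / (δ ^ 2 + Real.sin y ^ 2)) :=
    continuous_const.add (continuous_const.mul
      (Real.continuous_cos.div (by fun_prop) fun y => (hpos y).ne'))
  have h1 : ∫ y in a..b, (δ ^ 2 + Real.sin y ^ 2)⁻¹ ≤
      ∫ y in a..b, (1 + s * (Real.cos y / (δ ^ 2 + Real.sin y ^ 2))) := by
    refine intervalIntegral.integral_mono_on hab (hc1.intervalIntegrable _ _)
      (hc2.intervalIntegrable _ _) fun y hy => ?_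
    have hw := (hpos y).ne'
    have hq : 1 + s * (Real.cos y / (δ ^ 2 + Real.sin y ^ 2)) =
        (δ ^ 2 + Real.sin y ^ 2 + s * Real.cos y) / (δ ^ 2 + Real.sin y ^ 2) := by
      field_simp
    rw [hq, inv_eq_one_div]
    refine div_le_div_of_nonneg_right ?_ (hpos y).le
    have h2 := hcos y hy
    have h3 : (s * Real.cos y) ^ 2 ≤ s * Real.cos y := by
      have : s * Real.cos y ≤ 1 := by
        refine le_of_sq_le_sq ?_ zero_le_one
        rw [mul_pow, hs, one_mul, one_pow]
        exact Real.cos_sq_le_one y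
      nlinarith
    rw [mul_pow, hs] at h3
    nlinarith [Real.sin_sq_add_cos_sq y, sq_nonneg δ]
  have h2 := intervalIntegral.integral_eq_sub_of_hasDerivAt (a := a) (b := b)
    (fun y _ => (hasDerivAt_id y).add ((hasDerivAt_arctan_sin hδ y).const_mul s))
    (hc2.intervalIntegrable _ _)
  rw [h2] at h1
  have hs1 : |s| ≤ 1 := by
    rw [← sq_le_one_iff_abs_le_one, hs]
  have hat : ∀ y, |s * (δ⁻¹ * Real.arctan (Real.sin y / δ))| ≤ δ⁻¹ * (Real.pi / 2) := fun y => by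
    rw [abs_mul, abs_mul, abs_of_pos (inv_pos.mpr hδ)]
    have : |Real.arctan (Real.sin y / δ)| ≤ Real.pi / 2 :=
      abs_le.mpr ⟨by linarith [Real.neg_pi_div_two_lt_arctan (Real.sin y / δ)],
        (Real.arctan_lt_pi_div_two _).le⟩
    calc |s| * (δ⁻¹ * |Real.arctan (Real.sin y / δ)|) ≤ 1 * (δ⁻¹ * (Real.pi / 2)) := by gcongr
      _ = _ := one_mul _
  have h3 := (abs_le.mp (hat b)).2
  have h4 := (abs_le.mp (hat a)).1
  have h5 : 1 ≤ δ⁻¹ := (one_le_inv₀ hδ).mpr hδ1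
  have h6 : 2 * Real.pi / δ = δ⁻¹ * Real.pi + δ⁻¹ * Real.pi := by field_simp; ring
  have h7 : Real.pi ≤ δ⁻¹ * Real.pi := le_mul_of_one_le_left Real.pi_pos.le h5
  simp only [Pi.add_apply, id] at h1
  rw [h6]
  linarith

theorem continuous_inv_sinT {δ : ℝ} (hδ : 0 < δ) :
    Continuous fun y : Torus => (δ ^ 2 + sinT y ^ 2)⁻¹ :=
  Continuous.inv₀ (continuous_const.add (continuous_sinT.pow 2)) fun y => by positivity

theorem integrable_of_continuous {f : Torus → ℝ} (hf : Continuous f) : Integrable f :=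
  hf.integrable_of_hasCompactSupport (HasCompactSupport.of_compactSpace f)

theorem integral_torus_inv_sin_sq_le {δ : ℝ} (hδ : 0 < δ) (hδ1 : δ ≤ 1) :
    ∫ y : Torus, (δ ^ 2 + sinT y ^ 2)⁻¹ ≤ 13 / δ := by
  rw [← AddCircle.intervalIntegral_preimage (2 * Real.pi) (-(Real.pi / 2))]
  have hc1 : Continuous fun y => (δ ^ 2 + Real.sin y ^ 2)⁻¹ :=
    Continuous.inv₀ (by fun_prop) fun y => by positivity
  have e : ∀ y : ℝ, sinT (y : Torus) = Real.sin y := fun _ => rfl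
  simp only [e]
  rw [← intervalIntegral.integral_add_adjacent_intervals (b := Real.pi / 2)
    (hc1.intervalIntegrable _ _) (hc1.intervalIntegrable _ _)]
  have h1 := integral_inv_sin_sq_le hδ hδ1 (a := -(Real.pi / 2)) (b := Real.pi / 2) (s := 1)
    (by linarith [Real.pi_pos]) (by norm_num)
    (fun y hy => by rw [one_mul]; exact Real.cos_nonneg_of_mem_Icc hy) (by ring)
  have h2 := integral_inv_sin_sq_le hδ hδ1 (a := Real.pi / 2)
    (b := -(Real.pi / 2) + 2 * Real.pi) (s := -1)
    (by linarith [Real.pi_pos]) (by norm_num)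
    (fun y hy => by
      have := Real.cos_nonpos_of_pi_div_two_le_of_le hy.1 (by linarith [hy.2])
      linarith) (by ring)
  have h3 : 2 * Real.pi / δ + 2 * Real.pi / δ ≤ 13 / δ := by
    rw [← add_div]
    gcongr
    linarith [Real.pi_lt_d2]
  linarith

/-- Cauchy–Schwarz with the weight `δ² + sin² y`, whose inverse has integral at most `13/δ`. -/
theorem integral_norm_le {δ X : ℝ} (hδ : 0 < δ) (hδ1 : δ ≤ 1) (hX : 0 ≤ X) (f : L2T)
    (h : δ ^ 2 * ‖f‖ ^ 2 + ‖mulSin f‖ ^ 2 ≤ X ^ 2) : ∫ y : Torus, ‖f y‖ ≤ 7 * (X / √δ) := by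
  have hsδ : 0 < √δ := Real.sqrt_pos.mpr hδ
  have hi1 : Integrable fun y : Torus => ‖f y‖ := ((Lp.memLp f).integrable (by norm_num)).norm
  have hi2 : Integrable fun y : Torus => ‖f y‖ ^ 2 := (Lp.memLp f).norm.integrable_sq
  have hi3 : Integrable fun y : Torus => sinT y ^ 2 * ‖f y‖ ^ 2 := by
    have := (Lp.memLp (mulSin f)).norm.integrable_sq
    refine this.congr ?_
    filter_upwards [coeFn_mulSin f] with y hy
    rw [hy, norm_mul, mul_pow, Complex.norm_real, Real.norm_eq_abs, sq_abs]
  have hi4 : Integrable fun y : Torus => (δ ^ 2 + sinT y ^ 2)⁻¹ :=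
    integrable_of_continuous (continuous_inv_sinT hδ)
  rcases hX.eq_or_lt with hX0 | hX0
  · have hf : f = 0 := by
      rw [← norm_eq_zero, ← sq_eq_zero_iff]
      rw [← hX0] at h
      have : δ ^ 2 * ‖f‖ ^ 2 ≤ 0 := by nlinarith [sq_nonneg ‖mulSin f‖]
      have h2 : 0 < δ ^ 2 := by positivity
      nlinarith [sq_nonneg ‖f‖]
    have h0 : ∫ y : Torus, ‖f y‖ = 0 := by
      rw [integral_eq_zero_iff_of_nonneg (fun _ => norm_nonneg _) hi1, hf]
      filter_upwards [Lp.coeFn_zero ℂ 2 (volume : Measure Torus)] with y hy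
      rw [hy]
      simp
    rw [h0]
    positivity
  -- Cauchy–Schwarz is done pointwise by Young's inequality; this `t` balances the two terms and
  -- yields `1/2 + 13/2 = 7`.
  obtain ⟨t, ht⟩ : ∃ t : ℝ, t = X * √δ := ⟨_, rfl⟩
  have ht0 : 0 < t := by rw [ht]; positivity
  have hpt : ∀ y : Torus, ‖f y‖ ≤ (2 * t)⁻¹ * (δ ^ 2 * ‖f y‖ ^ 2 + sinT y ^ 2 * ‖f y‖ ^ 2) +
      t / 2 * (δ ^ 2 + sinT y ^ 2)⁻¹ := by
    intro y
    have hw : 0 < δ ^ 2 + sinT y ^ 2 := by positivity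
    set w := δ ^ 2 + sinT y ^ 2
    have : (2 * t)⁻¹ * (w * ‖f y‖ ^ 2) + t / 2 * w⁻¹ - ‖f y‖ =
        (2 * t * w)⁻¹ * (w * ‖f y‖ - t) ^ 2 := by
      field_simp
      ring
    have h2 : 0 ≤ (2 * t * w)⁻¹ * (w * ‖f y‖ - t) ^ 2 := by positivity
    rw [← add_mul]
    linarith
  have hi5 : Integrable fun y : Torus => δ ^ 2 * ‖f y‖ ^ 2 + sinT y ^ 2 * ‖f y‖ ^ 2 :=
    (hi2.const_mul (δ ^ 2)).add hi3
  have hi6 : Integrable fun y : Torus =>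
      (2 * t)⁻¹ * (δ ^ 2 * ‖f y‖ ^ 2 + sinT y ^ 2 * ‖f y‖ ^ 2) +
        t / 2 * (δ ^ 2 + sinT y ^ 2)⁻¹ := (hi5.const_mul (2 * t)⁻¹).add (hi4.const_mul (t / 2))
  have h1 := integral_mono hi1 hi6 hpt
  have h2 : ∫ y : Torus, ((2 * t)⁻¹ * (δ ^ 2 * ‖f y‖ ^ 2 + sinT y ^ 2 * ‖f y‖ ^ 2) +
      t / 2 * (δ ^ 2 + sinT y ^ 2)⁻¹) = (2 * t)⁻¹ * (δ ^ 2 * ‖f‖ ^ 2 + ‖mulSin f‖ ^ 2) +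
      t / 2 * ∫ y : Torus, (δ ^ 2 + sinT y ^ 2)⁻¹ := by
    rw [integral_add (hi5.const_mul (2 * t)⁻¹)
      (hi4.const_mul (t / 2)), integral_const_mul, integral_const_mul,
      integral_add (hi2.const_mul (δ ^ 2)) hi3, integral_const_mul, norm_sq_eq_integral f,
      norm_mulSin_sq_eq_integral]
  have h1' := h1.trans_eq h2
  have h3 := integral_torus_inv_sin_sq_le hδ hδ1
  have hδs : δ = √δ ^ 2 := (Real.sq_sqrt hδ.le).symm
  calc ∫ y : Torus, ‖f y‖ ≤ _ := h1'
    _ ≤ (2 * t)⁻¹ * X ^ 2 + t / 2 * (13 / δ) := by gcongr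
    _ = 7 * (X / √δ) := by
      rw [ht]
      generalize √δ = q at *
      rw [hδs]
      field_simp
      norm_num

/-! ### The test function `exp (k (cos y - 1))` -/

/-- The function `exp (k (cos y - 1))`. -/
def bumpC (k : ℝ) : C(Torus, ℂ) :=
  ⟨fun x => (Real.exp (k * (cosT x - 1)) : ℂ), Complex.continuous_ofReal.comp
    (Real.continuous_exp.comp (continuous_const.mul (continuous_cosT.sub continuous_const)))⟩

/-- The function `exp (k (cos y - 1))` as an element of `L²`. -/
def bump (k : ℝ) : L2T := ContinuousMap.toLp 2 volume ℂ (bumpC k)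

theorem coeFn_bump (k : ℝ) :
    bump k =ᵐ[volume] fun x => (Real.exp (k * (cosT x - 1)) : ℂ) :=
  ContinuousMap.coeFn_toLp (p := 2) (𝕜 := ℂ) volume (bumpC k)

theorem integral_congr_torus {F G : Torus → ℂ} (h : F =ᵐ[volume] G) {φ : ℝ → ℂ}
    (hp : Function.Periodic φ (2 * Real.pi)) :
    ∫ y in (0 : ℝ)..(2 * Real.pi), F (y : Torus) * φ y =
      ∫ y in (0 : ℝ)..(2 * Real.pi), G (y : Torus) * φ y := by
  have key : ∀ F : Torus → ℂ, ∫ y in (0 : ℝ)..(2 * Real.pi), F (y : Torus) * φ y =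
      ∫ a : Torus, F a * hp.lift a := by
    intro F
    rw [← AddCircle.intervalIntegral_preimage (2 * Real.pi) 0]
    simp
  rw [key, key]
  refine integral_congr_ae ?_
  filter_upwards [h] with a ha
  rw [ha]

theorem weakDeriv_bump (k : ℝ) : (bump k, (-(k : ℂ)) • mulSin (bump k)) ∈ weakDerivGraph := by
  intro φ hφ
  have hd : Continuous (deriv φ) := hφ.1.continuous_deriv (by simp)
  have hdp : Function.Periodic (deriv φ) (2 * Real.pi) := fun y => by
    have : (fun x => φ (x + 2 * Real.pi)) = φ := funext hφ.2
    rw [← deriv_comp_add_const, this]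
  have h2 : ((-(k : ℂ)) • mulSin (bump k) : L2T) =ᵐ[volume]
      fun x => -(k : ℂ) * (sinT x * (Real.exp (k * (cosT x - 1)) : ℂ)) := by
    filter_upwards [Lp.coeFn_smul (-(k : ℂ)) (mulSin (bump k)), coeFn_mulSin (bump k),
      coeFn_bump k] with x h1 h2 h3
    rw [h1, Pi.smul_apply, h2, h3, smul_eq_mul]
  change ∫ y in (0 : ℝ)..(2 * Real.pi), bump k (y : Torus) * deriv φ y =
    -∫ y in (0 : ℝ)..(2 * Real.pi), ((-(k : ℂ)) • mulSin (bump k) : L2T) (y : Torus) * φ y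
  rw [integral_congr_torus (coeFn_bump k) hdp, integral_congr_torus h2 hφ.2]
  have hder : ∀ y : ℝ, HasDerivAt (fun y : ℝ => (Real.exp (k * (Real.cos y - 1)) : ℂ))
      (-(k : ℂ) * (Real.sin y * (Real.exp (k * (Real.cos y - 1)) : ℂ))) y := by
    intro y
    have h := ((((Real.hasDerivAt_cos y).sub_const 1).const_mul k).exp).ofReal_comp
    convert h using 1
    push_cast
    ring
  have e1 : φ (2 * Real.pi) = φ 0 := by simpa using hφ.2 0
  have e := intervalIntegral.integral_mul_deriv_eq_deriv_mul (a := 0) (b := 2 * Real.pi)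
    (fun x _ => hder x) (fun x _ => ((hφ.1.differentiable (by simp)) x).hasDerivAt)
    (Continuous.intervalIntegrable (by fun_prop) _ _) (hd.intervalIntegrable _ _)
  rw [e1, Real.cos_two_pi, Real.cos_zero, sub_self, zero_sub] at e
  exact e

/-- Since `ψ' = -k sin y ψ`, integrating by parts gives `2k‖sin y ψ‖² = ⟨cos y ψ, ψ⟩`. -/
theorem sq_norm_weakDeriv_bump_le (k : ℝ) (hk : 0 ≤ k) :
    2 * (k * ‖mulSin (bump k)‖) ^ 2 ≤ k * ‖bump k‖ ^ 2 := by
  set ψ := bump k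
  have h1 := weakDeriv_bump k
  have e1 := inner_weakDeriv (weakDeriv_mulSin h1) h1
  have e2 := congrArg Complex.re e1
  rw [inner_smul_right, map_smul, inner_add_left, inner_smul_left,
    mulSin_symm (mulSin (bump k))] at e2
  simp only [map_neg, Complex.conj_ofReal, Complex.add_re, Complex.neg_re, neg_mul,
    Complex.re_ofReal_mul, neg_neg, re_inner_self] at e2
  have e3 := (le_abs_self _).trans (abs_re_inner_le (mulCos ψ) ψ)
  have e4 : ‖mulCos ψ‖ * ‖ψ‖ ≤ ‖ψ‖ ^ 2 := by
    nlinarith [norm_mulCos_le ψ, norm_nonneg ψ]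
  have e5 : 2 * (k * ‖mulSin ψ‖ ^ 2) ≤ ‖ψ‖ ^ 2 := by linarith
  nlinarith [mul_le_mul_of_nonneg_left e5 hk]

theorem coeFn_one : one =ᵐ[volume] fun _ => (1 : ℂ) :=
  Lp.coeFn_const 2 (volume : Measure Torus) (1 : ℂ)

theorem sq_norm_bump_eq (k : ℝ) :
    ‖bump k‖ ^ 2 = ∫ x : Torus, Real.exp (k * (cosT x - 1)) ^ 2 := by
  rw [norm_sq_eq_integral]
  refine integral_congr_ae ?_
  filter_upwards [coeFn_bump k] with x hx
  rw [hx, Complex.norm_real, Real.norm_eq_abs, sq_abs]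

theorem continuous_exp_cosT (k : ℝ) : Continuous fun x : Torus => Real.exp (k * (cosT x - 1)) :=
  Real.continuous_exp.comp (continuous_const.mul (continuous_cosT.sub continuous_const))

theorem cosT_le_one (x : Torus) : cosT x ≤ 1 := by
  have := norm_cosT_le x
  rw [Complex.norm_real] at this
  exact (le_abs_self _).trans this

theorem sq_norm_bump_le (k : ℝ) (hk : 0 ≤ k) : ‖bump k‖ ^ 2 ≤ ‖inner ℂ (bump k) one‖ := by
  have h1 : inner ℂ (bump k) one = ((∫ x : Torus, Real.exp (k * (cosT x - 1)) : ℝ) : ℂ) := by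
    rw [L2.inner_def, ← integral_complex_ofReal]
    refine integral_congr_ae ?_
    filter_upwards [coeFn_bump k, coeFn_one] with x hx h1
    rw [hx, h1]
    simp only [RCLike.inner_apply, Complex.conj_ofReal, one_mul]
  rw [h1, Complex.norm_real, sq_norm_bump_eq]
  refine le_trans ?_ (le_abs_self _)
  refine integral_mono (integrable_of_continuous ((continuous_exp_cosT k).pow 2))
    (integrable_of_continuous (continuous_exp_cosT k)) fun x => ?_
  have h2 : Real.exp (k * (cosT x - 1)) ≤ 1 := by
    rw [Real.exp_le_one_iff]
    exact mul_nonpos_of_nonneg_of_nonpos hk (by linarith [cosT_le_one x])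
  have h3 := Real.exp_pos (k * (cosT x - 1))
  change Real.exp (k * (cosT x - 1)) ^ 2 ≤ Real.exp (k * (cosT x - 1))
  nlinarith

theorem sq_norm_bump_ge {r : ℝ} (hr : 1 ≤ r) : 1 / (3 * r) ≤ ‖bump (r ^ 2)‖ ^ 2 := by
  have hr0 : 0 < r := by linarith
  rw [sq_norm_bump_eq, ← AddCircle.intervalIntegral_preimage (2 * Real.pi) 0]
  have hc : Continuous fun y : ℝ => Real.exp (r ^ 2 * (Real.cos y - 1)) ^ 2 := by fun_prop
  have h1 : ∫ y in (0 : ℝ)..r⁻¹, Real.exp (r ^ 2 * (Real.cos y - 1)) ^ 2 ≤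
      ∫ y in (0 : ℝ)..(0 + 2 * Real.pi), Real.exp (r ^ 2 * (Real.cos y - 1)) ^ 2 := by
    refine intervalIntegral.integral_mono_interval le_rfl (by positivity) ?_ ?_
      (hc.intervalIntegrable _ _)
    · have : r⁻¹ ≤ 1 := inv_le_one_of_one_le₀ hr
      linarith [Real.pi_gt_three]
    · exact Filter.Eventually.of_forall fun y => sq_nonneg _
  have h2 : ∫ _ in (0 : ℝ)..r⁻¹, (1 / 3 : ℝ) ≤
      ∫ y in (0 : ℝ)..r⁻¹, Real.exp (r ^ 2 * (Real.cos y - 1)) ^ 2 := by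
    refine intervalIntegral.integral_mono_on (by positivity)
      (continuous_const.intervalIntegrable _ _) (hc.intervalIntegrable _ _) fun y hy => ?_
    -- On `[0, 1/r]`, the bound `cos y ≥ 1 - y²/2` keeps the exponent of `ψ²` above `-1`, and `e⁻¹ ≥
    -- 1/3`.
    have h3 : -1 ≤ 2 * (r ^ 2 * (Real.cos y - 1)) := by
      have h4 := Real.one_sub_sq_div_two_le_cos (x := y)
      have h5 : (r * y) ^ 2 ≤ 1 := by
        refine pow_le_one₀ (mul_nonneg hr0.le hy.1) ?_
        rw [mul_comm, ← le_div_iff₀ hr0, one_div]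
        exact hy.2
      nlinarith [sq_nonneg r]
    have h6 : Real.exp (-1) ≤ Real.exp (2 * (r ^ 2 * (Real.cos y - 1))) := Real.exp_le_exp.mpr h3
    have h7 : (1 / 3 : ℝ) ≤ Real.exp (-1) := by
      rw [Real.exp_neg, one_div]
      exact inv_anti₀ (Real.exp_pos 1) (by linarith [Real.exp_one_lt_d9])
    rw [← Real.exp_nat_mul]
    push_cast
    linarith
  rw [intervalIntegral.integral_const, smul_eq_mul, sub_zero] at h2
  have h8 : 1 / (3 * r) = r⁻¹ * (1 / 3) := by field_simp
  rw [h8]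
  exact h2.trans h1

/-- The lower bound for the energy of the solution with right hand side `1`. -/
theorem energy_ge {u u₁ u₂ : L2T} {b r : ℝ} (h1 : (u, u₁) ∈ weakDerivGraph)
    (h2 : (u₁, u₂) ∈ weakDerivGraph) (hf : one = u₂ - u - (Complex.I * (b : ℂ)) • mulSin u)
    (hr : 1 ≤ r) (hb : |b| = r ^ 3) : 1 / (15 * r ^ 3) ≤ ‖u‖ ^ 2 + ‖u₁‖ ^ 2 := by
  have hr0 : 0 < r := by linarith
  have hg := weakDeriv_bump (r ^ 2)
  have hB1 := sq_norm_bump_le (r ^ 2) (by positivity)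
  have hB2 := sq_norm_bump_ge hr
  have hB3 := sq_norm_weakDeriv_bump_le (r ^ 2) (by positivity)
  set ψ := bump (r ^ 2)
  have hψ : 0 < ‖ψ‖ := by
    have : 0 < ‖ψ‖ ^ 2 := lt_of_lt_of_le (by positivity) hB2
    refine (norm_nonneg ψ).lt_of_ne' fun h => ?_
    rw [h] at this
    norm_num at this
  have hS : r ^ 2 * ‖mulSin ψ‖ ≤ r * ‖ψ‖ := by
    refine le_of_sq_le_sq ?_ (by positivity)
    nlinarith [sq_nonneg (r ^ 2 * ‖mulSin ψ‖)]
  have e1 := inner_weakDeriv hg h2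
  have e2 := inner_weakDeriv hg h1
  rw [inner_smul_left] at e1 e2
  simp only [map_neg, Complex.conj_ofReal] at e1 e2
  -- The key property of this bump: `sin y ψ` is a multiple of `ψ'`, so the large term `b⟨ψ, sin y
  -- u⟩` becomes a derivative falling on `u`. With `|b| = r³` only one factor `r` remains, matching
  -- the term with `u''`.
  have e3 : ((r ^ 2 : ℝ) : ℂ) * inner ℂ (mulSin ψ) u = inner ℂ ψ u₁ := by linear_combination -e2
  have e4 : inner ℂ ψ u₂ = ((r ^ 2 : ℝ) : ℂ) * inner ℂ (mulSin ψ) u₁ := by linear_combination e1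
  have n1 : ‖inner ℂ ψ u₂‖ ≤ r * ‖ψ‖ * ‖u₁‖ := by
    rw [e4, norm_mul, Complex.norm_real, Real.norm_of_nonneg (by positivity)]
    calc r ^ 2 * ‖inner ℂ (mulSin ψ) u₁‖ ≤ r ^ 2 * (‖mulSin ψ‖ * ‖u₁‖) := by
          gcongr
          exact norm_inner_le_norm _ _
      _ = r ^ 2 * ‖mulSin ψ‖ * ‖u₁‖ := by ring
      _ ≤ _ := by gcongr
  have n2 : ‖(Complex.I * (b : ℂ)) * inner ℂ ψ (mulSin u)‖ ≤ r * (‖ψ‖ * ‖u₁‖) := by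
    rw [← mulSin_symm, norm_mul, norm_mul, Complex.norm_I, one_mul, Complex.norm_real,
      Real.norm_eq_abs, hb]
    have e5 := congrArg norm e3
    rw [norm_mul, Complex.norm_real, Real.norm_of_nonneg (by positivity)] at e5
    calc r ^ 3 * ‖inner ℂ (mulSin ψ) u‖ = r * (r ^ 2 * ‖inner ℂ (mulSin ψ) u‖) := by ring
      _ = r * ‖inner ℂ ψ u₁‖ := by rw [e5]
      _ ≤ _ := by
        gcongr
        exact norm_inner_le_norm _ _
  have n3 : ‖inner ℂ ψ one‖ ≤ r * ‖ψ‖ * ‖u₁‖ + ‖ψ‖ * ‖u‖ + r * (‖ψ‖ * ‖u₁‖) := by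
    rw [hf, inner_sub_right, inner_sub_right, inner_smul_right]
    refine (norm_sub_le _ _).trans (add_le_add ((norm_sub_le _ _).trans
      (add_le_add n1 (norm_inner_le_norm _ _))) n2)
  have n4 : ‖ψ‖ ≤ r * (2 * ‖u₁‖ + ‖u‖) := by
    refine le_of_mul_le_mul_right (a := ‖ψ‖) ?_ hψ
    have : ‖u‖ ≤ r * ‖u‖ := le_mul_of_one_le_left (norm_nonneg _) hr
    nlinarith
  have n5 : 1 / (3 * r) ≤ r ^ 2 * (5 * (‖u‖ ^ 2 + ‖u₁‖ ^ 2)) := by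
    refine hB2.trans ((pow_le_pow_left₀ hψ.le n4 2).trans ?_)
    rw [mul_pow]
    gcongr
    nlinarith [sq_nonneg (2 * ‖u‖ - ‖u₁‖)]
  rw [div_le_iff₀ (by positivity)] at n5 ⊢
  linarith

/-! ### Bounds for the inverse -/

/-- The resolvent bounds for `u'' - u - i b sin y u = f` with `|b| = q ^ 6`. -/
theorem norm_le_and_integral_norm_le {u u₁ u₂ f : L2T} {b q : ℝ} (h1 : (u, u₁) ∈ weakDerivGraph)
    (h2 : (u₁, u₂) ∈ weakDerivGraph) (hf : f = u₂ - u - (Complex.I * (b : ℂ)) • mulSin u)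
    (hq : 0 < q) (hb : |b| = q ^ 6) :
    ‖u‖ ≤ 6 * (‖f‖ / q ^ 4) ∧ ∫ y : Torus, ‖u y‖ ≤ 56 * (‖f‖ / q ^ 5) := by
  have i1 := sq_norm_add_sq_norm_deriv_le h1 h2 hf
  have i2 := abs_mul_sq_norm_mulSin_le h1 h2 hf
  have hb' : |b| = (q ^ 2) ^ 3 := by rw [hb]; ring
  rw [hb'] at i2
  obtain ⟨hU, hS⟩ := energy_system (norm_nonneg f) (norm_nonneg u)
    (norm_nonneg (mulSin u)) (pow_pos hq 2) (norm_mulSin_le u) i1 i2 (sq_norm_le_mulSin h1)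
  have hU' : ‖u‖ ≤ 6 * (‖f‖ / q ^ 4) := by
    rw [← mul_div_assoc, le_div_iff₀ (by positivity)]
    linarith
  have hS' : ‖mulSin u‖ ≤ 4 * (‖f‖ / q ^ 6) := by
    rw [← mul_div_assoc, le_div_iff₀ (by positivity)]
    linarith
  refine ⟨hU', ?_⟩
  -- For small `b` there is no layer: the energy estimate with `δ = 1` is enough. Otherwise `δ = q⁻²
  -- = |b|^{-1/3}` is the layer width, and `6² + 4² ≤ 8²` gives the constant `7 · 8 = 56`.
  rcases le_total q 1 with hq1 | hq1
  · have hUF : ‖u‖ ≤ ‖f‖ := by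
      rcases (norm_nonneg u).eq_or_lt with h | h
      · rw [← h]
        exact norm_nonneg f
      · refine le_of_mul_le_mul_right (a := ‖u‖) ?_ h
        nlinarith [sq_nonneg ‖u₁‖]
    have h3 := integral_norm_le one_pos le_rfl (X := 2 * ‖f‖) (by positivity) u (by
      have := pow_le_pow_left₀ (norm_nonneg _) (norm_mulSin_le u) 2
      have := pow_le_pow_left₀ (norm_nonneg _) hUF 2
      nlinarith [sq_nonneg ‖f‖])
    rw [Real.sqrt_one, div_one] at h3
    have h4 : ‖f‖ ≤ ‖f‖ / q ^ 5 := by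
      rw [le_div_iff₀ (by positivity)]
      exact mul_le_of_le_one_right (norm_nonneg _) (pow_le_one₀ hq.le hq1)
    linarith [norm_nonneg f]
  · have hX : ((q ^ 2)⁻¹) ^ 2 * ‖u‖ ^ 2 + ‖mulSin u‖ ^ 2 ≤ (8 * (‖f‖ / q ^ 6)) ^ 2 := by
      have a1 : (q ^ 2)⁻¹ * ‖u‖ ≤ 6 * (‖f‖ / q ^ 6) := by
        calc (q ^ 2)⁻¹ * ‖u‖ ≤ (q ^ 2)⁻¹ * (6 * (‖f‖ / q ^ 4)) := by gcongr
          _ = _ := by field_simp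
      have a2 := pow_le_pow_left₀ (by positivity) a1 2
      have a3 := pow_le_pow_left₀ (norm_nonneg _) hS' 2
      rw [← mul_pow]
      nlinarith [sq_nonneg (‖f‖ / q ^ 6)]
    have h3 := integral_norm_le (δ := (q ^ 2)⁻¹) (by positivity)
      (inv_le_one_of_one_le₀ (one_le_pow₀ hq1)) (by positivity) u hX
    rw [Real.sqrt_inv, Real.sqrt_sq hq.le] at h3
    refine h3.trans_eq ?_
    field_simp
    ring

theorem rpow_neg_eq_inv_pow {x p : ℝ} (hx : 0 < x) (n m : ℕ) (hp : p = -(n / m)) :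
    x ^ p = ((x ^ (1 / m : ℝ)) ^ n)⁻¹ := by
  rw [hp, Real.rpow_neg hx.le, ← Real.rpow_natCast, ← Real.rpow_mul hx.le]
  congr 2
  ring

theorem inverse_bounds {ν β : ℝ} (hν : 0 < ν) (hβ : β ≠ 0) {T : L2T →L[ℂ] L2T}
    (hT : IsBoundedInverse (opL1 ν β) T) :
    (∀ f : L2T, ‖T f‖ ≤ 56 * |β| ^ (-(2 / 3) : ℝ) * ν ^ (1 / 3 : ℝ) * ‖f‖) ∧
    (∀ f : L2T, ∫ y, ‖(T f : L2T) y‖ ≤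
      56 * |β| ^ (-(5 / 6) : ℝ) * ν ^ (2 / 3 : ℝ) * ‖f‖) ∧
    (ν ^ 2 ≤ |β| → (1 / 15) * ν / |β| ≤ ‖inner ℂ (T one) one‖) := by
  have hβ0 : 0 < |β| := abs_pos.mpr hβ
  have e1 := rpow_neg_eq_inv_pow hβ0 4 6 (p := -(2 / 3)) (by norm_num)
  have e2 := rpow_neg_eq_inv_pow hβ0 5 6 (p := -(5 / 6)) (by norm_num)
  have e3 : ν ^ (2 / 3 : ℝ) = (ν ^ (1 / 3 : ℝ)) ^ 2 := by
    rw [← Real.rpow_natCast, ← Real.rpow_mul hν.le]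
    norm_num
  have e4 : ν = (ν ^ (1 / 3 : ℝ)) ^ 3 := by
    rw [← Real.rpow_natCast, ← Real.rpow_mul hν.le]
    norm_num
  have e5 : |β| = (|β| ^ (1 / (6 : ℕ) : ℝ)) ^ 6 := by
    rw [← Real.rpow_natCast, ← Real.rpow_mul hβ0.le]
    norm_num
  have hB0 : 0 < |β| ^ (1 / (6 : ℕ) : ℝ) := Real.rpow_pos_of_pos hβ0 _
  have hn0 : 0 < ν ^ (1 / 3 : ℝ) := Real.rpow_pos_of_pos hν _
  rw [e1, e2, e3]
  -- With `B = |β|^{1/6}` and `n = ν^{1/3}` every fractional power becomes an integer one, and `|b|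
  -- = (B/n)⁶`.
  generalize |β| ^ (1 / (6 : ℕ) : ℝ) = B at *
  generalize ν ^ (1 / 3 : ℝ) = n at *
  have hb : |β / ν ^ 2| = (B / n) ^ 6 := by
    rw [abs_div, e5, abs_of_pos (by positivity : 0 < ν ^ 2), e4]
    field_simp
  have hν' : (ν : ℂ) ≠ 0 := Complex.ofReal_ne_zero.mpr hν.ne'
  have hq : 0 < B / n := by positivity
  have hsol : ∀ f : L2T, ∃ u₁ u₂ : L2T, (T f, u₁) ∈ weakDerivGraph ∧ (u₁, u₂) ∈ weakDerivGraph ∧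
      (ν : ℂ)⁻¹ • f = u₂ - T f - (Complex.I * ((β / ν ^ 2 : ℝ) : ℂ)) • mulSin (T f) := by
    intro f
    obtain ⟨hm, hu⟩ := hT.2 f
    obtain ⟨u, hu1⟩ : ∃ u : H2, (u : L2T) = T f := ⟨⟨_, hm⟩, rfl⟩
    have hu2 : opL1Fun ν β u = f := by
      rw [show u = ⟨_, hm⟩ from Subtype.ext hu1]
      exact hu
    obtain ⟨u₁, h1, h2⟩ := exists_weakDeriv_of_mem_H2 u
    rw [opL1Fun_apply hν.ne', hu1] at hu2
    refine ⟨u₁, _, hu1 ▸ h1, h2, ?_⟩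
    exact (inv_smul_eq_iff₀ hν').mpr hu2.symm
  have hnorm : ∀ f : L2T, ‖(ν : ℂ)⁻¹ • f‖ = ‖f‖ / n ^ 3 := fun f => by
    rw [norm_smul, norm_inv, Complex.norm_real, Real.norm_of_nonneg hν.le, ← e4, inv_mul_eq_div]
  refine ⟨fun f => ?_, fun f => ?_, fun hle => ?_⟩
  · obtain ⟨u₁, u₂, h1, h2, h3⟩ := hsol f
    have h4 := (norm_le_and_integral_norm_le h1 h2 h3 hq hb).1
    rw [hnorm] at h4
    refine h4.trans ?_
    have h5 : 56 * (B ^ 4)⁻¹ * n * ‖f‖ = 56 * (‖f‖ / n ^ 3 / (B / n) ^ 4) := by field_simp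
    rw [h5]
    gcongr
    norm_num
  · obtain ⟨u₁, u₂, h1, h2, h3⟩ := hsol f
    have h4 := (norm_le_and_integral_norm_le h1 h2 h3 hq hb).2
    rw [hnorm] at h4
    refine h4.trans_eq ?_
    field_simp
  · obtain ⟨u₁, u₂, h1, h2, h3⟩ := hsol one
    -- `ν T 1` solves the rescaled equation with right-hand side exactly `1`; the condition `ν² ≤
    -- |β|` is `|b| ≥ 1`.
    have g1 := weakDerivGraph.smul_mem (ν : ℂ) h1
    have g2 := weakDerivGraph.smul_mem (ν : ℂ) h2
    have g3 : one = (ν : ℂ) • u₂ - (ν : ℂ) • T one -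
        (Complex.I * ((β / ν ^ 2 : ℝ) : ℂ)) • mulSin ((ν : ℂ) • T one) := by
      have h4 := congrArg ((ν : ℂ) • ·) h3
      simp only [smul_smul, mul_inv_cancel₀ hν', one_smul] at h4
      refine h4.trans ?_
      rw [map_smul]
      module
    have hr : 1 ≤ (B / n) ^ 2 := by
      refine one_le_pow₀ ?_
      rw [one_le_div hn0]
      refine le_of_pow_le_pow_left₀ (n := 6) (by norm_num) hB0.le ?_
      rw [← e5]
      refine le_trans (le_of_eq ?_) hle
      rw [e4]
      ring
    have g4 := energy_ge g1 g2 g3 hr (by rw [hb]; ring)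
    have g5 := sq_norm_add_sq_norm_deriv g1 g2 g3
    have g6 := (neg_le_abs _).trans (Complex.abs_re_le_norm (inner ℂ ((ν : ℂ) • T one) one))
    rw [inner_smul_left, Complex.conj_ofReal, norm_mul, Complex.norm_real,
      Real.norm_of_nonneg hν.le] at g6
    rw [inner_smul_left, Complex.conj_ofReal] at g5
    have g7 : 1 / (15 * ((B / n) ^ 2) ^ 3) = ν * ((1 / 15) * ν / |β|) := by
      rw [e5, e4]
      field_simp
    rw [g7] at g4
    refine le_of_mul_le_mul_left ?_ hν
    linarith

end KolmogorovFlow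

end

theorem lemma5p4 :
    ∃ C c : ℝ, 0 < C ∧ 0 < c ∧
      (∀ ν β : ℝ, 0 < ν → β ≠ 0 →
        ∃ T : KolmogorovFlow.L2T →L[ℂ] KolmogorovFlow.L2T,
          KolmogorovFlow.IsBoundedInverse (KolmogorovFlow.opL1 ν β) T ∧
          (∀ f : KolmogorovFlow.L2T,
            ‖T f‖ ≤ C * |β| ^ (-(2 / 3) : ℝ) * ν ^ (1 / 3 : ℝ) * ‖f‖) ∧
          (∀ f : KolmogorovFlow.L2T,
            ∫ y, ‖(T f : KolmogorovFlow.L2T) y‖ ≤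
              C * |β| ^ (-(5 / 6) : ℝ) * ν ^ (2 / 3 : ℝ) * ‖f‖) ∧
          (ν ^ 2 ≤ |β| →
            c * ν / |β| ≤ ‖inner ℂ (T KolmogorovFlow.one) KolmogorovFlow.one‖)) ∧
      (∀ (ν γ kf : ℝ) (k₁ k₃ : ℤ), 0 < ν → 0 < kf →
        (k₁ : ℝ) ^ 2 + (k₃ : ℝ) ^ 2 = kf ^ 2 → kf ^ 2 = 1 →
        c * |k₁ * γ| ^ (1 / 2 : ℝ) ≤
          KolmogorovFlow.pseudospectralBound KolmogorovFlow.starNorm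
            (KolmogorovFlow.opQ1L' ν γ kf k₁ k₃)) := by
  refine ⟨56, (1 / 32) ^ 4 / 2, by norm_num, by norm_num, fun ν β hν hβ => ?_,
    fun ν γ kf k₁ k₃ hν _ hk hkf => KolmogorovFlow.pseudospectralBound_ge hν hk hkf⟩
  obtain ⟨T, hT⟩ := KolmogorovFlow.exists_isBoundedInverse hν hβ
  obtain ⟨h1, h2, h3⟩ := KolmogorovFlow.inverse_bounds hν hβ hT
  refine ⟨T, hT, h1, h2, fun hle => le_trans ?_ (h3 hle)⟩
  -- The common constant `c` comes from the pseudospectral bound and is far below the `1/15`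
  -- available here.
  gcongr ?_ * ν / |β|
  norm_num
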